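/- Let $r>0$, $\lambda>0$, $c_1,c_2>0$, $\delta_1,\delta_2>0$ with $\delta_1+\delta_2=1$ and $c_1/\delta_1>c_2/\delta_2$. Let $(T_k)_{k\ge1}$ be i.i.d. exponential random variables with parameter $\lambda$, and let $(\sigma_k)_{k\ge1}$ be i.i.d. positive random variables with probability density $f$ on $(0,\infty)$, independent of $(T_k)$. Put $\theta_k=T_1+\dots+T_k$, let $N(t)$ be the number of $k\ge 1$ with $\theta_k\le t$ (a Poisson process of intensity $\lambda$), and for $i=1,2$ let $$U_i(t)=e^{rt}u_i+\frac{c_i}{r}(e^{rt}-1)-\delta_i\sum_{k=1}^{N(t)}e^{r(t-\theta_k)}\sigma_k,\qquad t\ge0 .$$ Let $T_{\max}(u_1,u_2)=\inf\{t\ge0:\max\{U_1(t),U_2(t)\}<0\}$ and $\tau_1(u_1)=\inf\{t\ge0:U_1(t)<0\}$, with $\inf\emptyset=\infty$, and for $s>0$ let $\Psi_{\max}(u_1,u_2,s)=E[e^{-sT_{\max}(u_1,u_2)}]$, with $e^{-s\infty}=0$. Let $D=\{(u_1,u_2)\in\mathbb R^2:u_1/\delta_1\le u_2/\delta_2\}$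 and $D_+=\{u\in D:\max\{u_1,u_2\}\ge0\}=\{u\in D:u_2\ge 0\}$. Fix $s>0$. Then $\Psi=\Psi_{\max}(\cdot,\cdot,s)$ is bounded on $D$, is differentiable on $D_+$ (relative to $D_+$, so that derivatives at boundary points of $D_+$ are one-sided), and satisfies, for every $(u_1,u_2)\in D_+$, $$\left(u_1+\frac{c_1}{r}\right)\frac{\partial\Psi}{\partial u_1}+\left(u_2+\frac{c_2}{r}\right)\frac{\partial\Psi}{\partial u_2}-\frac{\lambda+s}{r}\Psi+\frac{\lambda}{r}\int_0^\infty\Psi(u_1-\delta_1z,u_2-\delta_2z)f(z)\,dz=0,$$ together with $\Psi(u_1,u_2)=1$ for all $(u_1,u_2)\in D$ with $u_1<0$ and $u_2<0$, and the boundary condition $$\Psi\left(u_1,\tfrac{\delta_2}{\delta_1}u_1\right)=E\left[e^{-s\tau_1(u_1)}\right]\qquad(u_1\in\mathbb R).$$ Moreover, $\Psi_{\max}(\cdot,\cdot,s)$ is the unique such function: every function that is bounded on $D$, is differentiable on $D_+$ relative to $D_+$, and satisfies the equation on $D_+$, equals $1$ on $\{u\in D:u_1<0,\ u_2<0\}$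 and satisfies the boundary condition, coincides with $\Psi_{\max}(\cdot,\cdot,s)$ on $D$. -/

import Mathlib

open MeasureTheory ProbabilityTheory
open scoped ENNReal

noncomputable section

namespace JointRuin

/-- The parameters of the two-dimensional risk model: interest rate `r`, premium rates `c₁, c₂`,
proportions `δ₁, δ₂`, claim arrival intensity `lam`, and the probability density `f` of the
(positive) claim sizes. -/
structure Params where
  r : ℝ
  c₁ : ℝ
  c₂ : ℝ
  δ₁ : ℝ
  δ₂ : ℝ
  lam : ℝ
  f : ℝ → ℝ
  r_pos : 0 < r
  c₁_pos : 0 < c₁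
  c₂_pos : 0 < c₂
  δ₁_pos : 0 < δ₁
  δ₂_pos : 0 < δ₂
  δ_add : δ₁ + δ₂ = 1
  lam_pos : 0 < lam
  premium_lt : c₂ / δ₂ < c₁ / δ₁
  f_meas : Measurable f
  f_nonneg : ∀ z, 0 ≤ f z

variable {Ω : Type*}

/-- The arrival time of the claim number `k + 1` (claims are indexed from `0`):
the sum of the first `k + 1` inter-arrival times. -/
def arrival (T : ℕ → Ω → ℝ) (k : ℕ) (ω : Ω) : ℝ :=
  ∑ i ∈ Finset.range (k + 1), T i ω

/-- The number `N(t)` of claims that arrived up to time `t`. -/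
def claimCount (T : ℕ → Ω → ℝ) (t : ℝ) (ω : Ω) : ℕ :=
  {k : ℕ | arrival T k ω ≤ t}.ncard

/-- The inter-arrival times `T` are i.i.d. exponential of parameter `lam` (so that `N` is a Poisson
process of intensity `lam`), the claim sizes `σ` are i.i.d. on `(0, ∞)` with density `f`, and the
two sequences are independent of each other. -/
structure IsClaimModel [MeasurableSpace Ω] (M : Params) (P : Measure Ω)
    (T σ : ℕ → Ω → ℝ) : Prop where
  meas_T : ∀ k, Measurable (T k)
  meas_σ : ∀ k, Measurable (σ k)
  law_T : ∀ k, P.map (T k) = expMeasure M.lam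
  law_σ : ∀ k, P.map (σ k) =
    (volume.restrict (Set.Ioi 0)).withDensity (fun z => ENNReal.ofReal (M.f z))
  indep_T : iIndepFun T P
  indep_σ : iIndepFun σ P
  indep : IndepFun (fun ω k => T k ω) (fun ω k => σ k ω) P

/-- The surplus at time `t` of a line of business with interest rate `r`, premium rate `c`,
proportion `δ` and initial reserve `u`. -/
def surplus (r c δ : ℝ) (T σ : ℕ → Ω → ℝ) (u t : ℝ) (ω : Ω) : ℝ :=
  Real.exp (r * t) * u + c / r * (Real.exp (r * t) - 1)
    - δ * ∑ k ∈ Finset.range (claimCount T t ω),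
        Real.exp (r * (t - arrival T k ω)) * σ k ω

/-- The risk process `U₁` started at `u₁`. -/
def U₁ (M : Params) (T σ : ℕ → Ω → ℝ) (u₁ t : ℝ) (ω : Ω) : ℝ :=
  surplus M.r M.c₁ M.δ₁ T σ u₁ t ω

/-- The risk process `U₂` started at `u₂`. -/
def U₂ (M : Params) (T σ : ℕ → Ω → ℝ) (u₂ t : ℝ) (ω : Ω) : ℝ :=
  surplus M.r M.c₂ M.δ₂ T σ u₂ t ω

/-- `inf {t ≥ 0 | X t < 0}`, which is `∞` when the path `X` never becomes negative. -/
def ruinTime (X : ℝ → ℝ) : ℝ≥0∞ :=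
  sInf (ENNReal.ofReal '' {t : ℝ | 0 ≤ t ∧ X t < 0})

/-- `e^{-s τ}` for `τ ∈ [0, ∞]`, with `e^{-s ∞} = 0`. -/
def expNeg (s : ℝ) (τ : ℝ≥0∞) : ℝ :=
  if τ = ⊤ then 0 else Real.exp (-s * τ.toReal)

/-- The joint ruin time `T_max(u₁, u₂)`. -/
def TMax (M : Params) (T σ : ℕ → Ω → ℝ) (u : ℝ × ℝ) (ω : Ω) : ℝ≥0∞ :=
  ruinTime fun t => max (U₁ M T σ u.1 t ω) (U₂ M T σ u.2 t ω)

/-- The ruin time `τ₁(u₁)` of the risk process `U₁`. -/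
def τ₁ (M : Params) (T σ : ℕ → Ω → ℝ) (u₁ : ℝ) (ω : Ω) : ℝ≥0∞ :=
  ruinTime fun t => U₁ M T σ u₁ t ω

/-- The Laplace transform `Ψ_max(u₁, u₂, s) = E[e^{-s T_max(u₁, u₂)}]`. -/
def PsiMax [MeasurableSpace Ω] (M : Params) (P : Measure Ω) (T σ : ℕ → Ω → ℝ) (s : ℝ)
    (u : ℝ × ℝ) : ℝ :=
  ∫ ω, expNeg s (TMax M T σ u ω) ∂P

/-- All pairs of reserves with `u₁/δ₁ ≤ u₂/δ₂`. -/
def domain (M : Params) : Set (ℝ × ℝ) :=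
  {u | u.1 / M.δ₁ ≤ u.2 / M.δ₂}

/-- The part of the domain where joint ruin has not yet occurred, `max u₁ u₂ ≥ 0`
(on the domain this says `u₂ ≥ 0`). -/
def liveDomain (M : Params) : Set (ℝ × ℝ) :=
  {u | u ∈ domain M ∧ 0 ≤ max u.1 u.2}

/-- The partial derivative of `g` in the first variable, relative to `S`
(the ordinary one at interior points of `S`, one-sided where `S` ends). -/
def partialFst (g : ℝ × ℝ → ℝ) (S : Set (ℝ × ℝ)) (u : ℝ × ℝ) : ℝ :=
  derivWithin (fun v => g (v, u.2)) {v | (v, u.2) ∈ S} u.1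

/-- The partial derivative of `g` in the second variable, relative to `S`. -/
def partialSnd (g : ℝ × ℝ → ℝ) (S : Set (ℝ × ℝ)) (u : ℝ × ℝ) : ℝ :=
  derivWithin (fun v => g (u.1, v)) {v | (u.1, v) ∈ S} u.2

/-- `g` satisfies the integro-differential equation at the point `u`. -/
def SatisfiesEquationAt (M : Params) (s : ℝ) (g : ℝ × ℝ → ℝ) (u : ℝ × ℝ) : Prop :=
  (u.1 + M.c₁ / M.r) * partialFst g (liveDomain M) u
    + (u.2 + M.c₂ / M.r) * partialSnd g (liveDomain M) u
    - (M.lam + s) / M.r * g u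
    + M.lam / M.r * ∫ z in Set.Ioi (0 : ℝ), g (u.1 - M.δ₁ * z, u.2 - M.δ₂ * z) * M.f z = 0

/-- `g` is a bounded solution of the boundary value problem: it is differentiable and satisfies the
integro-differential equation as long as joint ruin has not occurred, it is `1` once both reserves
are negative, and it takes the prescribed values on the ray `u₂ = (δ₂/δ₁) u₁`. -/
structure IsSolution [MeasurableSpace Ω] (M : Params) (P : Measure Ω) (T σ : ℕ → Ω → ℝ) (s : ℝ)
    (g : ℝ × ℝ → ℝ) : Prop where
  bounded : ∃ C : ℝ, ∀ u ∈ domain M, |g u| ≤ C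
  differentiable : DifferentiableOn ℝ g (liveDomain M)
  equation : ∀ u ∈ liveDomain M, SatisfiesEquationAt M s g u
  ruined : ∀ u ∈ domain M, u.1 < 0 → u.2 < 0 → g u = 1
  boundary : ∀ u₁ : ℝ, g (u₁, M.δ₂ / M.δ₁ * u₁) = ∫ ω, expNeg s (τ₁ M T σ u₁ ω) ∂P

end JointRuin

end

/-! Dividing line `i` by `δᵢ` and discounting to time 0 makes both lines pay the same claims: line
`i` is negative at time `t` iff `yᵢ < S(t) + bᵢ exp(-r t)`, where `S(t)` is the discounted claim
total, `yᵢ = uᵢ/δᵢ + bᵢ` and `bᵢ = cᵢ/(r δᵢ)`, with `b₂ < b₁`. The right side decreases between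
claims, so ruin of reserves that start nonnegative can only be caused by a claim. Almost surely
`T_max` is thus a measurable function of the two i.i.d. sequences (`expNeg_TMax`), and `Ψ` is an
integral `psi` over their product law.

Equation. Splitting off the first claim gives the renewal equation `psi_renewal`, valid wherever
ruin has not yet occurred, also outside `D`. Along the deterministic flow, `exp(-(λ+s)x) Ψ(flow x
u)` is the tail integral of a function that is right-continuous at 0, so its right derivative exists
there and is the one the equation prescribes.

Differentiability. The flow controls only one direction. For the full derivative, the first
inter-arrival time `x` is integrated out: it multiplies all later thresholds by `exp(-r x)`, so one
of the first `n` claims causes joint ruin iff `r x < level n`, where `level n` is built from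
logarithms of the capitals by `min` and `max`. The exponential law turns this event into a smooth
function of the level. The level is Lipschitz where `y₂` is bounded below, and at a given point it
has a kink with probability zero, because claim sizes have a density. Hence the expectation is
differentiable (`differentiableAt_survivalMean`), and the sum over the ruining claim converges
geometrically together with its derivatives (`differentiableAt_psiSeries`).

Uniqueness. Follow the flow from a point of `D_+` until it meets the boundary ray, or for ever if it
does not. Integrating the equation for the difference of two solutions shows that a bound `K`
improves to `λ/(λ+s) K` (`abs_sub_le_ratio_mul`); iterating gives zero. -/

noncomputable section

namespace JointRuin

open Filter Topology

/-! ### Prepending and resampling a coordinate of an i.i.d. sequence -/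

section Sequences

variable {X : Type*}

/-- The sequence with head `x` and tail `t`. -/
def cons (x : X) (t : ℕ → X) : ℕ → X
  | 0 => x
  | k + 1 => t k

@[simp] lemma cons_zero (x : X) (t : ℕ → X) : cons x t 0 = x := rfl

@[simp] lemma cons_succ (x : X) (t : ℕ → X) (k : ℕ) : cons x t (k + 1) = t k := rfl

variable [MeasurableSpace X]

@[fun_prop]
lemma measurable_cons : Measurable fun p : X × (ℕ → X) => cons p.1 p.2 := by
  refine measurable_pi_iff.2 fun k => ?_
  cases k with
  | zero => exact measurable_fst
  | succ k => exact (measurable_pi_apply k).comp measurable_snd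

/-- The infinite product is determined by finite boxes, and the preimage of a box is a box in the
head times a box in the tail. This is what allows conditioning on the first claim. -/
lemma measurePreserving_cons (ρ : Measure X) [IsProbabilityMeasure ρ] :
    MeasurePreserving (fun p : X × (ℕ → X) => cons p.1 p.2)
      (ρ.prod (Measure.infinitePi fun _ : ℕ => ρ)) (Measure.infinitePi fun _ : ℕ => ρ) := by
  classical
  refine ⟨measurable_cons, Measure.eq_infinitePi _ fun s t ht => ?_⟩
  rw [Measure.map_apply measurable_cons (.pi s.countable_toSet fun i _ => ht i)]
  have : (fun p : X × (ℕ → X) => cons p.1 p.2) ⁻¹' (Set.pi s t) =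
      (if 0 ∈ s then t 0 else Set.univ) ×ˢ
        Set.pi (s.preimage Nat.succ Nat.succ_injective.injOn : Finset ℕ) fun k => t (k + 1) := by
    ext ⟨x, y⟩
    simp only [Set.mem_preimage, Set.mem_pi, Finset.mem_coe, Set.mem_prod, Finset.mem_preimage]
    constructor
    · intro h
      refine ⟨?_, fun k hk => h (k + 1) hk⟩
      split_ifs with h0
      · exact h 0 h0
      · trivial
    · rintro ⟨h0, h1⟩ k hk
      cases k with
      | zero => simpa [hk] using h0
      | succ k => exact h1 k hk
  rw [this, Measure.prod_prod, Measure.infinitePi_pi _ (fun i _ => ht _)]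
  have h2 : s.filter (· ≠ 0) = (s.preimage Nat.succ Nat.succ_injective.injOn).map
      ⟨Nat.succ, Nat.succ_injective⟩ := by
    ext k
    cases k <;> simp
  have h3 : ∏ i ∈ s, ρ (t i) = (if 0 ∈ s then ρ (t 0) else 1) * ∏ i ∈ s.filter (· ≠ 0), ρ (t i) := by
    rw [← Finset.prod_filter_mul_prod_filter_not s (· ≠ 0), mul_comm]
    congr 1
    simp only [not_not]
    rw [Finset.filter_eq' s 0]
    split_ifs <;> simp
  rw [h3, h2, Finset.prod_map]
  congr 1
  split_ifs <;> simp

/-- Replacing one coordinate by an independent copy keeps the law. It serves to vary a single claim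
size with everything else frozen. -/
lemma measurePreserving_update (ρ : Measure X) [IsProbabilityMeasure ρ] (i : ℕ) :
    MeasurePreserving (fun p : X × (ℕ → X) => Function.update p.2 i p.1)
      (ρ.prod (Measure.infinitePi fun _ : ℕ => ρ)) (Measure.infinitePi fun _ : ℕ => ρ) := by
  classical
  have hm : Measurable fun p : X × (ℕ → X) => Function.update p.2 i p.1 := by
    refine measurable_pi_iff.2 fun k => ?_
    by_cases h : k = i
    · subst h; simpa using measurable_fst
    · simpa [Function.update_of_ne h, Function.comp_def] using
        (measurable_pi_apply k).comp measurable_snd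
  refine ⟨hm, Measure.eq_infinitePi _ fun s t ht => ?_⟩
  rw [Measure.map_apply hm (.pi s.countable_toSet fun i _ => ht i)]
  have : (fun p : X × (ℕ → X) => Function.update p.2 i p.1) ⁻¹' (Set.pi s t) =
      (if i ∈ s then t i else Set.univ) ×ˢ Set.pi (s.erase i : Finset ℕ) t := by
    ext ⟨x, y⟩
    simp only [Set.mem_preimage, Set.mem_pi, Finset.mem_coe, Set.mem_prod, Finset.mem_erase]
    constructor
    · intro h
      refine ⟨?_, fun k hk => by simpa [Function.update_of_ne hk.1] using h k hk.2⟩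
      split_ifs with h0
      · simpa using h i h0
      · trivial
    · rintro ⟨h0, h1⟩ k hk
      by_cases h : k = i
      · subst h; simpa [hk] using h0
      · simpa [Function.update_of_ne h] using h1 k ⟨h, hk⟩
  rw [this, Measure.prod_prod, Measure.infinitePi_pi _ (fun i _ => ht _)]
  split_ifs with h
  · exact Finset.mul_prod_erase s (fun i => ρ (t i)) h
  · simp [Finset.erase_eq_of_notMem h]

end Sequences

/-! ### Joint ruin in normalized, discounted coordinates -/

/-- The time of claim number `k` for the inter-arrival times `t`. -/
def clock (t : ℕ → ℝ) (k : ℕ) : ℝ := ∑ i ∈ Finset.range (k + 1), t i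

/-- The claims `0, …, k`, discounted to time `0`. -/
def discClaims (r : ℝ) (t z : ℕ → ℝ) (k : ℕ) : ℝ :=
  ∑ j ∈ Finset.range (k + 1), Real.exp (-r * clock t j) * z j

/-- The asymptotic discounted premium income of the first line, per unit of its proportion. -/
def Params.b₁ (M : Params) : ℝ := M.c₁ / (M.r * M.δ₁)

/-- The asymptotic discounted premium income of the second line, per unit of its proportion. -/
def Params.b₂ (M : Params) : ℝ := M.c₂ / (M.r * M.δ₂)

/-- The normalized capital, reserves plus all discounted future premiums, of the first line. -/
def Params.y₁ (M : Params) (x : ℝ) : ℝ := x / M.δ₁ + M.b₁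

/-- The normalized capital, reserves plus all discounted future premiums, of the second line. -/
def Params.y₂ (M : Params) (x : ℝ) : ℝ := x / M.δ₂ + M.b₂

/-- Both reserves are negative right after claim number `k`. -/
def RuinedAt (M : Params) (u : ℝ × ℝ) (t z : ℕ → ℝ) (k : ℕ) : Prop :=
  M.y₁ u.1 < discClaims M.r t z k + M.b₁ * Real.exp (-M.r * clock t k) ∧
  M.y₂ u.2 < discClaims M.r t z k + M.b₂ * Real.exp (-M.r * clock t k)

/-- No claim with number less than `n` causes joint ruin. -/
def Survives (M : Params) (u : ℝ × ℝ) (t z : ℕ → ℝ) (n : ℕ) : Prop :=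
  ∀ j < n, ¬ RuinedAt M u t z j

open Classical in
/-- The discount factor at the joint ruin time, if ruin is caused by claim number `k`, and `0`
otherwise. -/
def ruinTerm (M : Params) (s : ℝ) (u : ℝ × ℝ) (t z : ℕ → ℝ) (k : ℕ) : ℝ :=
  if RuinedAt M u t z k ∧ Survives M u t z k then Real.exp (-s * clock t k) else 0

open Classical in
/-- The discount factor at the joint ruin time as a function of the sequences of
inter-arrival times and claim sizes. -/
def ruinDiscount (M : Params) (s : ℝ) (u : ℝ × ℝ) (t z : ℕ → ℝ) : ℝ :=
  if max u.1 u.2 < 0 then 1 else ∑' k, ruinTerm M s u t z k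

lemma Params.b₁_pos (M : Params) : 0 < M.b₁ :=
  div_pos M.c₁_pos (mul_pos M.r_pos M.δ₁_pos)

lemma Params.b₂_pos (M : Params) : 0 < M.b₂ :=
  div_pos M.c₂_pos (mul_pos M.r_pos M.δ₂_pos)

lemma Params.b₂_lt_b₁ (M : Params) : M.b₂ < M.b₁ := by
  have h1 : M.b₁ = M.c₁ / M.δ₁ / M.r := by rw [Params.b₁, div_div, mul_comm]
  have h2 : M.b₂ = M.c₂ / M.δ₂ / M.r := by rw [Params.b₂, div_div, mul_comm]
  rw [h1, h2]
  exact div_lt_div_of_pos_right M.premium_lt M.r_pos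

lemma ruinTerm_eq_zero_of_ne {M : Params} {s : ℝ} {u : ℝ × ℝ} {t z : ℕ → ℝ} {k j : ℕ}
    (hk : RuinedAt M u t z k ∧ Survives M u t z k) (hj : j ≠ k) :
    ruinTerm M s u t z j = 0 := by
  refine if_neg fun h => ?_
  rcases lt_or_gt_of_ne hj with h1 | h1
  · exact hk.2 j h1 h.1
  · exact h.2 k h1 hk.1

lemma summable_ruinTerm (M : Params) (s : ℝ) (u : ℝ × ℝ) (t z : ℕ → ℝ) :
    Summable (ruinTerm M s u t z) := by
  by_cases h : ∃ k, RuinedAt M u t z k ∧ Survives M u t z k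
  · obtain ⟨k, hk⟩ := h
    exact (hasSum_single k fun j hj => ruinTerm_eq_zero_of_ne hk hj).summable
  · push Not at h
    have : ruinTerm M s u t z = 0 := by
      funext k
      exact if_neg fun hk => h k hk.1 hk.2
    rw [this]
    exact summable_zero

/-- The surplus is the positive factor `δ exp(r t)` times the difference of the two sides. The claim
sum on the right does not involve `c` or `δ`, so it is common to both lines. -/
lemma surplus_neg_iff {r c δ : ℝ} (hr : 0 < r) (hδ : 0 < δ) {Ω : Type*} (T σ : ℕ → Ω → ℝ)
    (x t : ℝ) (ω : Ω) :
    surplus r c δ T σ x t ω < 0 ↔ x / δ + c / (r * δ) <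
      ∑ k ∈ Finset.range (claimCount T t ω), Real.exp (-r * clock (fun i => T i ω) k) * σ k ω
        + c / (r * δ) * Real.exp (-r * t) := by
  have h : surplus r c δ T σ x t ω = δ * Real.exp (r * t) * (x / δ + c / (r * δ) -
      (∑ k ∈ Finset.range (claimCount T t ω), Real.exp (-r * clock (fun i => T i ω) k) * σ k ω
        + c / (r * δ) * Real.exp (-r * t))) := by
    have h1 : ∑ k ∈ Finset.range (claimCount T t ω), Real.exp (r * (t - arrival T k ω)) * σ k ω =
        Real.exp (r * t) * ∑ k ∈ Finset.range (claimCount T t ω),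
          Real.exp (-r * clock (fun i => T i ω) k) * σ k ω := by
      rw [Finset.mul_sum]
      refine Finset.sum_congr rfl fun k _ => ?_
      rw [← mul_assoc, ← Real.exp_add]
      congr 2
      simp only [arrival, clock]
      ring
    have h2 : Real.exp (r * t) * Real.exp (-(r * t)) = 1 := by
      rw [← Real.exp_add]; simp
    rw [surplus, h1]
    field_simp
    linear_combination c * h2
  have hpos : 0 < δ * Real.exp (r * t) := by positivity
  rw [h, mul_neg_iff]
  constructor
  · rintro (h | h)
    · linarith [h.2]
    · exact absurd h.1 hpos.not_gt
  · intro h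
    exact .inl ⟨hpos, by linarith⟩

lemma strictMono_clock {t : ℕ → ℝ} (ht : ∀ k, 0 < t k) : StrictMono (clock t) := by
  refine strictMono_nat_of_lt_succ fun n => ?_
  rw [clock, clock, Finset.sum_range_succ _ (n + 1)]
  linarith [ht (n + 1)]

lemma clock_pos {t : ℕ → ℝ} (ht : ∀ k, 0 < t k) (k : ℕ) : 0 < clock t k :=
  Finset.sum_pos (fun i _ => ht i) ⟨0, by simp⟩

/-! ### The joint ruin time along a single path -/

section Pathwise

variable {Ω : Type*} {T σ : ℕ → Ω → ℝ} {ω : Ω}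

lemma claimCount_of_lt (hT : ∀ k, 0 < T k ω) {x : ℝ} (hx : x < T 0 ω) :
    claimCount T x ω = 0 := by
  have : {k : ℕ | arrival T k ω ≤ x} = ∅ := by
    ext k
    simp only [Set.mem_ofPred_eq, Set.mem_empty_iff_false, iff_false, not_le]
    refine hx.trans_le ?_
    have := (strictMono_clock (t := fun i => T i ω) hT).monotone k.zero_le
    simpa [clock, arrival] using this
  rw [claimCount, this, Set.ncard_empty]

lemma claimCount_of_mem (hT : ∀ k, 0 < T k ω) {x : ℝ} {n : ℕ}
    (h1 : clock (fun i => T i ω) n ≤ x) (h2 : x < clock (fun i => T i ω) (n + 1)) :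
    claimCount T x ω = n + 1 := by
  have hm := strictMono_clock (t := fun i => T i ω) hT
  have : {k : ℕ | arrival T k ω ≤ x} = Finset.range (n + 1) := by
    ext k
    simp only [Set.mem_ofPred_eq, Finset.coe_range, Set.mem_Iio]
    change clock (fun i => T i ω) k ≤ x ↔ _
    constructor
    · intro h
      exact hm.lt_iff_lt.1 (h.trans_lt h2)
    · intro h
      exact (hm.monotone (Nat.lt_succ_iff.1 h)).trans h1
  rw [claimCount, this, Set.ncard_coe_finset, Finset.card_range]

lemma exists_clock_le_lt
    (hlim : Tendsto (clock fun i => T i ω) atTop atTop) {x : ℝ} (hx : T 0 ω ≤ x) :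
    ∃ n, clock (fun i => T i ω) n ≤ x ∧ x < clock (fun i => T i ω) (n + 1) := by
  classical
  have hex : ∃ n, x < clock (fun i => T i ω) n := (hlim.eventually_gt_atTop x).exists
  have hne : Nat.find hex ≠ 0 := by
    intro h
    have := Nat.find_spec hex
    rw [h] at this
    simp [clock] at this
    linarith
  obtain ⟨n, hn⟩ := Nat.exists_eq_succ_of_ne_zero hne
  refine ⟨n, ?_, ?_⟩
  · exact not_lt.1 (Nat.find_min hex (by omega))
  · have := Nat.find_spec hex
    rwa [hn] at this

lemma surplus_neg_iff_of_mem (M : Params) (hT : ∀ k, 0 < T k ω) {u : ℝ × ℝ} {x : ℝ} {n : ℕ}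
    (h1 : clock (fun i => T i ω) n ≤ x) (h2 : x < clock (fun i => T i ω) (n + 1)) :
    max (U₁ M T σ u.1 x ω) (U₂ M T σ u.2 x ω) < 0 ↔
      M.y₁ u.1 < discClaims M.r (fun i => T i ω) (fun i => σ i ω) n + M.b₁ * Real.exp (-M.r * x) ∧
      M.y₂ u.2 < discClaims M.r (fun i => T i ω) (fun i => σ i ω) n
        + M.b₂ * Real.exp (-M.r * x) := by
  rw [max_lt_iff, U₁, U₂, surplus_neg_iff M.r_pos M.δ₁_pos, surplus_neg_iff M.r_pos M.δ₂_pos,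
    claimCount_of_mem hT h1 h2]
  rfl

/-- Joint ruin is always caused by a claim. -/
lemma expNeg_TMax (M : Params) (s : ℝ) (u : ℝ × ℝ) (hT : ∀ k, 0 < T k ω)
    (hlim : Tendsto (clock fun i => T i ω) atTop atTop) :
    expNeg s (TMax M T σ u ω) = ruinDiscount M s u (fun i => T i ω) (fun i => σ i ω) := by
  have hr := M.r_pos
  have hmono := strictMono_clock (t := fun i => T i ω) hT
  have hzero : max (U₁ M T σ u.1 0 ω) (U₂ M T σ u.2 0 ω) = max u.1 u.2 := by
    simp [U₁, U₂, surplus, claimCount_of_lt hT (hT 0)]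
  by_cases hu : max u.1 u.2 < 0
  · have : TMax M T σ u ω = 0 := by
      refine le_antisymm (sInf_le ⟨0, ⟨le_rfl, ?_⟩, by simp⟩) zero_le
      simpa only [hzero] using hu
    rw [this, ruinDiscount, if_pos hu]
    simp [expNeg]
  -- The threshold `S + b exp(-r x)` decreases in `x` between claims, so negativity at `x` is
  -- inherited from the last claim before `x`. Before the first claim it would force both initial
  -- reserves to be negative.
  have key : ∀ x : ℝ, 0 ≤ x → max (U₁ M T σ u.1 x ω) (U₂ M T σ u.2 x ω) < 0 →
      ∃ n, clock (fun i => T i ω) n ≤ x ∧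
        RuinedAt M u (fun i => T i ω) (fun i => σ i ω) n := by
    intro x hx hneg
    rcases lt_or_ge x (T 0 ω) with hx0 | hx0
    · exfalso
      apply hu
      rw [max_lt_iff, U₁, U₂, surplus_neg_iff hr M.δ₁_pos, surplus_neg_iff hr M.δ₂_pos,
        claimCount_of_lt hT hx0] at hneg
      have he : Real.exp (-M.r * x) ≤ 1 := Real.exp_le_one_iff.2 (by nlinarith)
      have hb1 := M.b₁_pos
      have hb2 := M.b₂_pos
      simp only [Finset.range_zero, Finset.sum_empty, zero_add] at hneg
      change u.1 / M.δ₁ + M.b₁ < M.b₁ * _ ∧ u.2 / M.δ₂ + M.b₂ < M.b₂ * _ at hneg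
      have h1 : u.1 / M.δ₁ < 0 := by nlinarith [hneg.1]
      have h2 : u.2 / M.δ₂ < 0 := by nlinarith [hneg.2]
      rw [max_lt_iff]
      exact ⟨neg_of_div_neg_left h1 M.δ₁_pos.le, neg_of_div_neg_left h2 M.δ₂_pos.le⟩
    · obtain ⟨n, h1, h2⟩ := exists_clock_le_lt hlim hx0
      refine ⟨n, h1, ?_⟩
      rw [surplus_neg_iff_of_mem M hT h1 h2] at hneg
      have he : Real.exp (-M.r * x) ≤ Real.exp (-M.r * clock (fun i => T i ω) n) :=
        Real.exp_le_exp.2 (by nlinarith)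
      have hb1 := M.b₁_pos
      have hb2 := M.b₂_pos
      exact ⟨hneg.1.trans_le (by gcongr), hneg.2.trans_le (by gcongr)⟩
  rw [ruinDiscount, if_neg hu]
  by_cases hex : ∃ n, RuinedAt M u (fun i => T i ω) (fun i => σ i ω) n
  · classical
    set k := Nat.find hex with hk
    have hk1 : RuinedAt M u (fun i => T i ω) (fun i => σ i ω) k := Nat.find_spec hex
    have hk2 : Survives M u (fun i => T i ω) (fun i => σ i ω) k :=
      fun j hj => Nat.find_min hex hj
    have hclock := (clock_pos (t := fun i => T i ω) hT k).le
    have : TMax M T σ u ω = ENNReal.ofReal (clock (fun i => T i ω) k) := by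
      refine le_antisymm (sInf_le ⟨_, ⟨hclock, ?_⟩, rfl⟩) (le_sInf ?_)
      · exact (surplus_neg_iff_of_mem M hT le_rfl (hmono k.lt_succ_self)).2 hk1
      · rintro _ ⟨x, ⟨hx, hneg⟩, rfl⟩
        obtain ⟨n, h1, h2⟩ := key x hx hneg
        exact ENNReal.ofReal_le_ofReal ((hmono.monotone (Nat.find_min' hex h2)).trans h1)
    rw [this, tsum_eq_single k fun j hj => ruinTerm_eq_zero_of_ne ⟨hk1, hk2⟩ hj, ruinTerm,
      if_pos ⟨hk1, hk2⟩, expNeg, if_neg ENNReal.ofReal_ne_top, ENNReal.toReal_ofReal hclock]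
  · have : TMax M T σ u ω = ⊤ := by
      have : {x : ℝ | 0 ≤ x ∧ max (U₁ M T σ u.1 x ω) (U₂ M T σ u.2 x ω) < 0} = ∅ := by
        ext x
        simp only [Set.mem_ofPred_eq, Set.mem_empty_iff_false, iff_false]
        rintro ⟨hx, hneg⟩
        obtain ⟨n, -, h2⟩ := key x hx hneg
        exact hex ⟨n, h2⟩
      rw [TMax, ruinTime, this, Set.image_empty, sInf_empty]
    have h0 : ∀ k, ruinTerm M s u (fun i => T i ω) (fun i => σ i ω) k = 0 :=
      fun k => if_neg fun h => hex ⟨k, h.1⟩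
    rw [this, expNeg, if_pos rfl]
    simp [h0]

end Pathwise

/-! ### The law of the paths and the exponential distribution -/

/-- The law of a single claim. -/
def claimLaw (M : Params) : Measure ℝ :=
  (volume.restrict (Set.Ioi 0)).withDensity (fun z => ENNReal.ofReal (M.f z))

/-- The joint law of the sequence of inter-arrival times and the sequence of claim sizes. -/
def pathLaw (M : Params) : Measure ((ℕ → ℝ) × (ℕ → ℝ)) :=
  (Measure.infinitePi fun _ : ℕ => expMeasure M.lam).prod
    (Measure.infinitePi fun _ : ℕ => claimLaw M)

instance (M : Params) : IsProbabilityMeasure (expMeasure M.lam) :=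
  isProbabilityMeasure_expMeasure M.lam_pos

lemma IsClaimModel.isProbabilityMeasure_claimLaw {Ω : Type*} [MeasurableSpace Ω] {P : Measure Ω}
    [IsProbabilityMeasure P] {M : Params} {T σ : ℕ → Ω → ℝ} (h : IsClaimModel M P T σ) :
    IsProbabilityMeasure (claimLaw M) := by
  rw [claimLaw, ← h.law_σ 0]
  exact Measure.isProbabilityMeasure_map (h.meas_σ 0).aemeasurable

lemma IsClaimModel.map_eq_pathLaw {Ω : Type*} [MeasurableSpace Ω] {P : Measure Ω}
    [IsProbabilityMeasure P] {M : Params} {T σ : ℕ → Ω → ℝ} (h : IsClaimModel M P T σ) :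
    P.map (fun ω => ((fun k => T k ω), fun k => σ k ω)) = pathLaw M := by
  have hT : Measurable fun ω k => T k ω := measurable_pi_iff.2 h.meas_T
  have hσ : Measurable fun ω k => σ k ω := measurable_pi_iff.2 h.meas_σ
  rw [(indepFun_iff_map_prod_eq_prod_map_map hT.aemeasurable hσ.aemeasurable).1 h.indep,
    (iIndepFun_iff_map_fun_eq_infinitePi_map h.meas_T).1 h.indep_T,
    (iIndepFun_iff_map_fun_eq_infinitePi_map h.meas_σ).1 h.indep_σ]
  simp only [h.law_T, h.law_σ]
  rfl

section ExponentialLaw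

lemma integral_expMeasure {l : ℝ} (hl : 0 < l) (g : ℝ → ℝ) :
    ∫ x, g x ∂expMeasure l = ∫ x in Set.Ioi 0, l * Real.exp (-l * x) * g x := by
  have hm : Measurable fun x => (exponentialPDFReal l x).toNNReal :=
    (measurable_exponentialPDFReal l).real_toNNReal
  have h : expMeasure l = volume.withDensity fun x => ((exponentialPDFReal l x).toNNReal : ℝ≥0∞) :=
    rfl
  -- The density is nonzero at 0, so it is matched with the indicator of the closed half-line.
  rw [h, integral_withDensity_eq_integral_smul hm, ← integral_Ici_eq_integral_Ioi,
    ← integral_indicator measurableSet_Ici]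
  refine integral_congr_ae (ae_of_all _ fun x => ?_)
  by_cases hx : 0 ≤ x
  · simp only [NNReal.smul_def, Real.coe_toNNReal _ (exponentialPDFReal_nonneg hl x), smul_eq_mul]
    rw [Set.indicator_of_mem (by exact hx)]
    simp [exponentialPDFReal, gammaPDFReal, hx]
  · simp only [NNReal.smul_def, Real.coe_toNNReal _ (exponentialPDFReal_nonneg hl x), smul_eq_mul]
    rw [Set.indicator_of_notMem (by exact hx)]
    simp [exponentialPDFReal, gammaPDFReal, hx]

lemma expMeasure_ae_pos {l : ℝ} : ∀ᵐ x ∂expMeasure l, 0 < x := by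
  have h : expMeasure l = volume.withDensity (gammaPDF 1 l) := rfl
  rw [h, ae_withDensity_iff (by exact (measurable_exponentialPDFReal l).ennreal_ofReal)]
  have h0 : ∀ᵐ x : ℝ, x ≠ 0 := by simp [ae_iff]
  filter_upwards [h0] with x hx hne
  by_contra h
  exact hne (gammaPDF_of_neg (lt_of_le_of_ne (not_lt.1 h) hx))

/-- The Laplace transform of an exponential variable, restricted to a half-line. -/
lemma integral_expMeasure_exp_ite {l s a : ℝ} (hl : 0 < l) (hs : 0 < s) (ha : 0 ≤ a) :
    ∫ x, (if a ≤ x then Real.exp (-s * x) else 0) ∂expMeasure l =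
      l / (l + s) * Real.exp (-(l + s) * a) := by
  rw [integral_expMeasure hl, ← integral_Ici_eq_integral_Ioi]
  have h1 : ∀ x, l * Real.exp (-l * x) * (if a ≤ x then Real.exp (-s * x) else 0) =
      (Set.Ici a).indicator (fun x => l * Real.exp (-(l + s) * x)) x := by
    intro x
    by_cases h : a ≤ x
    · rw [if_pos h, Set.indicator_of_mem (by exact h), mul_assoc, ← Real.exp_add]
      ring_nf
    · rw [if_neg h, Set.indicator_of_notMem (by exact h), mul_zero]
  simp_rw [h1]
  rw [setIntegral_indicator measurableSet_Ici, Set.Ici_inter_Ici, sup_eq_right.2 ha,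
    integral_Ici_eq_integral_Ioi, integral_const_mul, integral_exp_mul_Ioi (by linarith)]
  have : l + s ≠ 0 := by positivity
  field_simp

lemma integral_expMeasure_exp {l s : ℝ} (hl : 0 < l) (hs : 0 < s) :
    ∫ x, Real.exp (-s * x) ∂expMeasure l = l / (l + s) := by
  have h := integral_expMeasure_exp_ite hl hs le_rfl
  rw [mul_zero, Real.exp_zero, mul_one] at h
  rw [← h]
  refine integral_congr_ae ?_
  filter_upwards [expMeasure_ae_pos] with x hx
  rw [if_pos hx.le]

end ExponentialLaw

section MeasurePreserving

lemma measurePreserving_prod_left_comm {A B C : Type*} [MeasurableSpace A] [MeasurableSpace B]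
    [MeasurableSpace C] (α : Measure A) (β : Measure B) (γ : Measure C) [SFinite α] [SFinite β]
    [SFinite γ] :
    MeasurePreserving (fun q : A × B × C => (q.2.1, q.1, q.2.2))
      (α.prod (β.prod γ)) (β.prod (α.prod γ)) :=
  (measurePreserving_prodAssoc β α γ).comp
    ((Measure.measurePreserving_swap.prod (MeasurePreserving.id γ)).comp
      (measurePreserving_prodAssoc α β γ).symm)

lemma _root_.MeasureTheory.MeasurePreserving.integral_comp_of_measurable {A B : Type*}
    [MeasurableSpace A] [MeasurableSpace B] {α : Measure A} {β : Measure B} {f : A → B}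
    (hf : MeasurePreserving f α β) {g : B → ℝ} (hg : Measurable g) :
    ∫ a, g (f a) ∂α = ∫ b, g b ∂β := by
  rw [← hf.map_eq, integral_map hf.measurable.aemeasurable hg.aestronglyMeasurable]

end MeasurePreserving

/-! ### Measurability and almost sure properties of paths -/

section PathLaw

variable (M : Params)

lemma claimLaw_ae_pos : ∀ᵐ x ∂claimLaw M, 0 < x := by
  rw [claimLaw, ae_withDensity_iff (by exact M.f_meas.ennreal_ofReal)]
  filter_upwards [ae_restrict_mem measurableSet_Ioi] with x hx _ using hx

lemma claimLaw_absolutelyContinuous : claimLaw M ≪ volume :=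
  (withDensity_absolutelyContinuous _ _).trans Measure.absolutelyContinuous_restrict

lemma integral_claimLaw (g : ℝ → ℝ) :
    ∫ z, g z ∂claimLaw M = ∫ z in Set.Ioi 0, g z * M.f z := by
  have hm : Measurable fun x => (M.f x).toNNReal := M.f_meas.real_toNNReal
  have h : claimLaw M = (volume.restrict (Set.Ioi 0)).withDensity
      fun x => ((M.f x).toNNReal : ℝ≥0∞) := rfl
  rw [h, integral_withDensity_eq_integral_smul hm]
  refine integral_congr_ae (ae_of_all _ fun x => ?_)
  simp only [NNReal.smul_def, Real.coe_toNNReal _ (M.f_nonneg x), smul_eq_mul, mul_comm]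

@[fun_prop]
lemma measurable_clock (n : ℕ) : Measurable fun t : ℕ → ℝ => clock t n := by
  unfold clock
  fun_prop

lemma measurableSet_ruinedAt (k : ℕ) :
    MeasurableSet {q : (ℝ × ℝ) × (ℕ → ℝ) × (ℕ → ℝ) | RuinedAt M q.1 q.2.1 q.2.2 k} := by
  have hd : Measurable fun q : (ℝ × ℝ) × (ℕ → ℝ) × (ℕ → ℝ) =>
      discClaims M.r q.2.1 q.2.2 k := by
    unfold discClaims
    fun_prop
  have hc : Measurable fun q : (ℝ × ℝ) × (ℕ → ℝ) × (ℕ → ℝ) =>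
      Real.exp (-M.r * clock q.2.1 k) := by fun_prop
  have h1 : Measurable fun q : (ℝ × ℝ) × (ℕ → ℝ) × (ℕ → ℝ) => M.y₁ q.1.1 := by
    unfold Params.y₁
    fun_prop
  have h2 : Measurable fun q : (ℝ × ℝ) × (ℕ → ℝ) × (ℕ → ℝ) => M.y₂ q.1.2 := by
    unfold Params.y₂
    fun_prop
  exact (measurableSet_lt h1 (hd.add (hc.const_mul _))).inter
    (measurableSet_lt h2 (hd.add (hc.const_mul _)))

lemma measurableSet_survives (n : ℕ) :
    MeasurableSet {q : (ℝ × ℝ) × (ℕ → ℝ) × (ℕ → ℝ) | Survives M q.1 q.2.1 q.2.2 n} := by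
  have : {q : (ℝ × ℝ) × (ℕ → ℝ) × (ℕ → ℝ) | Survives M q.1 q.2.1 q.2.2 n} =
      ⋂ j ∈ Finset.range n,
        {q : (ℝ × ℝ) × (ℕ → ℝ) × (ℕ → ℝ) | RuinedAt M q.1 q.2.1 q.2.2 j}ᶜ := by
    ext q
    simp [Survives]
  rw [this]
  exact Finset.measurableSet_biInter _ fun j _ => (measurableSet_ruinedAt M j).compl

lemma measurable_ruinTerm (s : ℝ) (k : ℕ) :
    Measurable fun q : (ℝ × ℝ) × (ℕ → ℝ) × (ℕ → ℝ) => ruinTerm M s q.1 q.2.1 q.2.2 k := by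
  classical
  unfold ruinTerm
  exact Measurable.ite ((measurableSet_ruinedAt M k).inter (measurableSet_survives M k))
    (by fun_prop) measurable_const

lemma measurable_ruinDiscount (s : ℝ) :
    Measurable fun q : (ℝ × ℝ) × (ℕ → ℝ) × (ℕ → ℝ) => ruinDiscount M s q.1 q.2.1 q.2.2 := by
  classical
  unfold ruinDiscount
  refine Measurable.ite (measurableSet_lt (by fun_prop) measurable_const) measurable_const ?_
  refine measurable_of_tendsto_metrizable
    (f := fun n (q : (ℝ × ℝ) × (ℕ → ℝ) × (ℕ → ℝ)) =>
      ∑ k ∈ Finset.range n, ruinTerm M s q.1 q.2.1 q.2.2 k)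
    (fun n => Finset.measurable_sum _ fun k _ => measurable_ruinTerm M s k) ?_
  exact tendsto_pi_nhds.2 fun q => (summable_ruinTerm M s q.1 q.2.1 q.2.2).hasSum.tendsto_sum_nat


variable [IsProbabilityMeasure (claimLaw M)]

instance : IsProbabilityMeasure (pathLaw M) := by
  rw [pathLaw]; infer_instance

lemma pathLaw_ae_pos : ∀ᵐ p ∂pathLaw M, (∀ k, 0 < p.1 k) ∧ ∀ k, 0 < p.2 k := by
  have h1 : ∀ᵐ t ∂Measure.infinitePi (fun _ : ℕ => expMeasure M.lam), ∀ k, 0 < t k :=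
    ae_all_iff.2 fun k =>
      (measurePreserving_eval_infinitePi (fun _ : ℕ => expMeasure M.lam) k).quasiMeasurePreserving.ae
        expMeasure_ae_pos
  have h2 : ∀ᵐ t ∂Measure.infinitePi (fun _ : ℕ => claimLaw M), ∀ k, 0 < t k :=
    ae_all_iff.2 fun k =>
      (measurePreserving_eval_infinitePi (fun _ : ℕ => claimLaw M) k).quasiMeasurePreserving.ae
        (claimLaw_ae_pos M)
  exact (Measure.quasiMeasurePreserving_fst.ae h1).and (Measure.quasiMeasurePreserving_snd.ae h2)

/-- Prepending an independent first arrival time and first claim preserves the law of the paths. -/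
lemma measurePreserving_cons_cons :
    MeasurePreserving (fun q : (ℝ × ℝ) × (ℕ → ℝ) × (ℕ → ℝ) =>
        (cons q.1.1 q.2.1, cons q.1.2 q.2.2))
      (((expMeasure M.lam).prod (claimLaw M)).prod (pathLaw M)) (pathLaw M) := by
  have h1 := (measurePreserving_cons (expMeasure M.lam)).prod
    (measurePreserving_cons (claimLaw M))
  have h2 := (MeasurePreserving.id (expMeasure M.lam)).prod
    (measurePreserving_prod_left_comm (claimLaw M)
      (Measure.infinitePi fun _ : ℕ => expMeasure M.lam)
      (Measure.infinitePi fun _ : ℕ => claimLaw M))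
  exact (h1.comp (measurePreserving_prodAssoc _ _ _).symm).comp
    (h2.comp (measurePreserving_prodAssoc _ _ _))

/-- Prepending an independent first arrival time and shifting the others. -/
lemma measurePreserving_cons_fst :
    MeasurePreserving (fun q : ℝ × (ℕ → ℝ) × (ℕ → ℝ) => (cons q.1 q.2.1, q.2.2))
      ((expMeasure M.lam).prod (pathLaw M)) (pathLaw M) := by
  have h := ((measurePreserving_cons (expMeasure M.lam)).prod
    (MeasurePreserving.id (Measure.infinitePi fun _ : ℕ => claimLaw M))).comp
    (measurePreserving_prodAssoc _ _ _).symm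
  exact h

lemma measurePreserving_update_snd (i : ℕ) :
    MeasurePreserving (fun q : ℝ × (ℕ → ℝ) × (ℕ → ℝ) => (q.2.1, Function.update q.2.2 i q.1))
      ((claimLaw M).prod (pathLaw M)) (pathLaw M) :=
  ((MeasurePreserving.id (Measure.infinitePi fun _ : ℕ => expMeasure M.lam)).prod
    (measurePreserving_update (claimLaw M) i)).comp
    (measurePreserving_prod_left_comm (claimLaw M)
      (Measure.infinitePi fun _ : ℕ => expMeasure M.lam)
      (Measure.infinitePi fun _ : ℕ => claimLaw M))

/-- The total of the first `n` inter-arrival times. -/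
def elapsed (t : ℕ → ℝ) (n : ℕ) : ℝ := ∑ i ∈ Finset.range n, t i

@[fun_prop]
lemma measurable_elapsed (n : ℕ) : Measurable fun t : ℕ → ℝ => elapsed t n := by
  unfold elapsed
  fun_prop

lemma elapsed_cons (x : ℝ) (t : ℕ → ℝ) (n : ℕ) : elapsed (cons x t) (n + 1) = x + elapsed t n := by
  rw [elapsed, Finset.sum_range_succ', add_comm]
  rfl

lemma clock_cons (x : ℝ) (t : ℕ → ℝ) (n : ℕ) : clock (cons x t) n = x + elapsed t n :=
  elapsed_cons x t n

lemma elapsed_nonneg {t : ℕ → ℝ} (ht : ∀ k, 0 < t k) (n : ℕ) : 0 ≤ elapsed t n :=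
  Finset.sum_nonneg fun i _ => (ht i).le

lemma integrable_exp_elapsed {s : ℝ} (hs : 0 < s) (n : ℕ) :
    Integrable (fun p : (ℕ → ℝ) × (ℕ → ℝ) => Real.exp (-s * elapsed p.1 n)) (pathLaw M) := by
  refine Integrable.of_bound (Measurable.aestronglyMeasurable (by fun_prop)) 1 ?_
  filter_upwards [pathLaw_ae_pos M] with p hp
  rw [Real.norm_eq_abs, Real.abs_exp, Real.exp_le_one_iff]
  nlinarith [elapsed_nonneg hp.1 n]

lemma integral_exp_elapsed {s : ℝ} (hs : 0 < s) (n : ℕ) :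
    ∫ p, Real.exp (-s * elapsed p.1 n) ∂pathLaw M = (M.lam / (M.lam + s)) ^ n := by
  induction n with
  | zero => simp [elapsed]
  | succ n ih =>
    rw [← (measurePreserving_cons_fst M).integral_comp_of_measurable (by fun_prop)]
    simp only [elapsed_cons, mul_add, Real.exp_add]
    rw [integral_prod_mul (fun x => Real.exp (-s * x))
      (fun p : (ℕ → ℝ) × (ℕ → ℝ) => Real.exp (-s * elapsed p.1 n)), ih,
      integral_expMeasure_exp M.lam_pos hs, pow_succ']

/-- The expectations of `exp(-elapsed n)` are powers of `λ/(λ+1) < 1`, hence summable. So the series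
of these variables is almost surely finite, its terms tend to 0, and the arrival times diverge. -/
lemma pathLaw_ae_tendsto_clock : ∀ᵐ p ∂pathLaw M, Tendsto (clock p.1) atTop atTop := by
  have hq : M.lam / (M.lam + 1) < 1 := by
    rw [div_lt_one] <;> linarith [M.lam_pos]
  have hq0 : 0 ≤ M.lam / (M.lam + 1) := by
    have := M.lam_pos
    positivity
  have h : ∫⁻ p, ∑' n, ENNReal.ofReal (Real.exp (-1 * elapsed p.1 n)) ∂pathLaw M ≠ ⊤ := by
    rw [lintegral_tsum fun n => by fun_prop]
    have : ∀ n, ∫⁻ p, ENNReal.ofReal (Real.exp (-1 * elapsed p.1 n)) ∂pathLaw M =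
        ENNReal.ofReal ((M.lam / (M.lam + 1)) ^ n) := by
      intro n
      rw [← integral_exp_elapsed M one_pos n, ofReal_integral_eq_lintegral_ofReal
        (integrable_exp_elapsed M one_pos n) (ae_of_all _ fun _ => (Real.exp_pos _).le)]
    simp_rw [this]
    exact (summable_geometric_of_lt_one hq0 hq).tsum_ofReal_ne_top
  filter_upwards [ae_lt_top (by fun_prop) h] with p hp
  have h1 := ENNReal.tendsto_atTop_zero_of_tsum_ne_top hp.ne
  have h2 : Tendsto (fun n => Real.exp (-1 * elapsed p.1 n)) atTop (𝓝 0) := by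
    have := (ENNReal.tendsto_toReal ENNReal.zero_ne_top).comp h1
    simpa [Function.comp_def, ENNReal.toReal_ofReal (Real.exp_pos _).le] using this
  have h3 : Tendsto (fun n => -1 * elapsed p.1 n) atTop atBot := Real.tendsto_exp_comp_nhds_zero.1 h2
  have h4 : Tendsto (elapsed p.1) atTop atTop := by
    have := tendsto_neg_atBot_atTop.comp h3
    simpa [Function.comp_def] using this
  exact h4.comp (tendsto_add_atTop_nat 1)

end PathLaw

/-! ### Flow, claims, and renewal at the first claim -/

/-- The reserves after a claim-free period of length `x`. -/
def flow (M : Params) (x : ℝ) (u : ℝ × ℝ) : ℝ × ℝ :=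
  (Real.exp (M.r * x) * (u.1 + M.c₁ / M.r) - M.c₁ / M.r,
    Real.exp (M.r * x) * (u.2 + M.c₂ / M.r) - M.c₂ / M.r)

/-- The reserves after a claim of size `w`. -/
def payClaim (M : Params) (w : ℝ) (u : ℝ × ℝ) : ℝ × ℝ :=
  (u.1 - M.δ₁ * w, u.2 - M.δ₂ * w)

/-- The Laplace transform of the joint ruin time in terms of the law of the paths. -/
def psi (M : Params) (s : ℝ) (u : ℝ × ℝ) : ℝ :=
  ∫ p, ruinDiscount M s u p.1 p.2 ∂pathLaw M

section RuinDiscount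

variable (M : Params)

/-- In the normalized coordinate the flow is pure multiplication by `exp(r x)` and a claim is a
plain translation, the same for both lines. -/
lemma Params.y₁_flow (x w : ℝ) (u : ℝ × ℝ) :
    M.y₁ (payClaim M w (flow M x u)).1 = Real.exp (M.r * x) * M.y₁ u.1 - w := by
  have := M.r_pos
  have := M.δ₁_pos
  simp only [payClaim, flow, Params.y₁, Params.b₁]
  field_simp
  ring

lemma Params.y₂_flow (x w : ℝ) (u : ℝ × ℝ) :
    M.y₂ (payClaim M w (flow M x u)).2 = Real.exp (M.r * x) * M.y₂ u.2 - w := by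
  have := M.r_pos
  have := M.δ₂_pos
  simp only [payClaim, flow, Params.y₂, Params.b₂]
  field_simp
  ring

lemma discClaims_cons (r x w : ℝ) (t z : ℕ → ℝ) (k : ℕ) :
    discClaims r (cons x t) (cons w z) (k + 1) =
      Real.exp (-r * x) * (w + discClaims r t z k) := by
  rw [discClaims, Finset.sum_range_succ', discClaims, mul_add, Finset.mul_sum, add_comm]
  congr 1
  · simp [clock]
  · refine Finset.sum_congr rfl fun j _ => ?_
    rw [clock_cons, mul_add, Real.exp_add, mul_assoc]
    rfl

lemma ruinedAt_cons_zero (u : ℝ × ℝ) (x w : ℝ) (t z : ℕ → ℝ) :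
    RuinedAt M u (cons x t) (cons w z) 0 ↔
      max (payClaim M w (flow M x u)).1 (payClaim M w (flow M x u)).2 < 0 := by
  have he : Real.exp (-M.r * x) * Real.exp (M.r * x) = 1 := by
    rw [← Real.exp_add]; simp
  have hp := Real.exp_pos (M.r * x)
  have key : ∀ y b : ℝ, y < Real.exp (-M.r * x) * w + b * Real.exp (-M.r * x) ↔
      Real.exp (M.r * x) * y - w - b < 0 := by
    intro y b
    rw [← mul_lt_mul_iff_right₀ hp, ← sub_neg]
    have : Real.exp (M.r * x) * y -
        Real.exp (M.r * x) * (Real.exp (-M.r * x) * w + b * Real.exp (-M.r * x)) =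
        Real.exp (M.r * x) * y - w - b := by linear_combination (-w - b) * he
    rw [this]
  have h1 : ∀ v, M.y₁ v - M.b₁ < 0 ↔ v < 0 := fun v => by
    simp [Params.y₁, div_lt_iff₀ M.δ₁_pos]
  have h2 : ∀ v, M.y₂ v - M.b₂ < 0 ↔ v < 0 := fun v => by
    simp [Params.y₂, div_lt_iff₀ M.δ₂_pos]
  simp only [RuinedAt, discClaims, clock, zero_add, Finset.sum_range_one, cons_zero, key]
  rw [← M.y₁_flow, ← M.y₂_flow, h1, h2, max_lt_iff]

/-- Multiplying both inequalities by `exp(r x)` moves the time origin to the first claim. The claim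
`w` then passes from the claim sum into the capital, which becomes that of the restarted process. -/
lemma ruinedAt_cons_succ (u : ℝ × ℝ) (x w : ℝ) (t z : ℕ → ℝ) (k : ℕ) :
    RuinedAt M u (cons x t) (cons w z) (k + 1) ↔
      RuinedAt M (payClaim M w (flow M x u)) t z k := by
  have he : Real.exp (-M.r * x) * Real.exp (M.r * x) = 1 := by
    rw [← Real.exp_add]; simp
  have hp := Real.exp_pos (M.r * x)
  have hc : clock (cons x t) (k + 1) = x + clock t k := clock_cons x t (k + 1)
  have key : ∀ y b D R : ℝ, y < Real.exp (-M.r * x) * (w + D) + b * (Real.exp (-M.r * x) * R) ↔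
      Real.exp (M.r * x) * y - w < D + b * R := by
    intro y b D R
    rw [← mul_lt_mul_iff_right₀ hp, ← sub_neg, ← sub_neg (b := D + b * R)]
    have : Real.exp (M.r * x) * y -
        Real.exp (M.r * x) * (Real.exp (-M.r * x) * (w + D) + b * (Real.exp (-M.r * x) * R)) =
        Real.exp (M.r * x) * y - w - (D + b * R) := by linear_combination (-w - D - b * R) * he
    rw [this]
  simp only [RuinedAt, discClaims_cons, hc, mul_add (-M.r), Real.exp_add, key, M.y₁_flow,
    M.y₂_flow]

lemma survives_zero (u : ℝ × ℝ) (t z : ℕ → ℝ) : Survives M u t z 0 :=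
  fun _ hj => absurd hj (Nat.not_lt_zero _)

lemma survives_succ (u : ℝ × ℝ) (t z : ℕ → ℝ) (n : ℕ) :
    Survives M u t z (n + 1) ↔ Survives M u t z n ∧ ¬ RuinedAt M u t z n := by
  constructor
  · exact fun h => ⟨fun j hj => h j (by omega), h n (by omega)⟩
  · rintro ⟨h1, h2⟩ j hj
    rcases Nat.lt_succ_iff_lt_or_eq.1 hj with h | rfl
    exacts [h1 j h, h2]

lemma survives_cons_succ (u : ℝ × ℝ) (x w : ℝ) (t z : ℕ → ℝ) (n : ℕ) :
    Survives M u (cons x t) (cons w z) (n + 1) ↔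
      ¬ RuinedAt M u (cons x t) (cons w z) 0 ∧
        Survives M (payClaim M w (flow M x u)) t z n := by
  constructor
  · exact fun h => ⟨h 0 (by omega), fun j hj =>
      (ruinedAt_cons_succ M u x w t z j).not.1 (h (j + 1) (by omega))⟩
  · rintro ⟨h0, h1⟩ j hj
    cases j with
    | zero => exact h0
    | succ j => exact (ruinedAt_cons_succ M u x w t z j).not.2 (h1 j (by omega))

/-- The discount factor at ruin, decomposed at the first claim. -/
lemma ruinDiscount_cons (s : ℝ) {u : ℝ × ℝ} (hu : 0 ≤ max u.1 u.2) (x w : ℝ) (t z : ℕ → ℝ) :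
    ruinDiscount M s u (cons x t) (cons w z) =
      Real.exp (-s * x) * ruinDiscount M s (payClaim M w (flow M x u)) t z := by
  rw [ruinDiscount, if_neg hu.not_gt, (summable_ruinTerm M s u _ _).tsum_eq_zero_add, ruinDiscount]
  have hc : ∀ k, clock (cons x t) (k + 1) = x + clock t k := fun k => clock_cons x t (k + 1)
  by_cases h : max (payClaim M w (flow M x u)).1 (payClaim M w (flow M x u)).2 < 0
  · have h0 := (ruinedAt_cons_zero M u x w t z).2 h
    have h1 : ∀ k, ruinTerm M s u (cons x t) (cons w z) (k + 1) = 0 := fun k =>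
      ruinTerm_eq_zero_of_ne ⟨h0, survives_zero M u _ _⟩ k.succ_ne_zero
    rw [if_pos h, ruinTerm, if_pos ⟨h0, survives_zero M u _ _⟩]
    simp [h1, clock]
  · have h0 := (ruinedAt_cons_zero M u x w t z).not.2 h
    have h1 : ∀ k, ruinTerm M s u (cons x t) (cons w z) (k + 1) =
        Real.exp (-s * x) * ruinTerm M s (payClaim M w (flow M x u)) t z k := by
      intro k
      have hiff : (RuinedAt M u (cons x t) (cons w z) (k + 1) ∧
          Survives M u (cons x t) (cons w z) (k + 1)) ↔
          (RuinedAt M (payClaim M w (flow M x u)) t z k ∧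
            Survives M (payClaim M w (flow M x u)) t z k) := by
        rw [ruinedAt_cons_succ, survives_cons_succ]
        simp [h0]
      rw [ruinTerm, ruinTerm, hc, mul_add, Real.exp_add]
      by_cases hk : RuinedAt M (payClaim M w (flow M x u)) t z k ∧
          Survives M (payClaim M w (flow M x u)) t z k
      · rw [if_pos hk, if_pos (hiff.2 hk)]
      · rw [if_neg hk, if_neg (hiff.not.2 hk), mul_zero]
    rw [if_neg h, ruinTerm, if_neg fun h2 => h0 h2.1, zero_add]
    simp_rw [h1]
    rw [tsum_mul_left]

lemma ruinTerm_nonneg (s : ℝ) (u : ℝ × ℝ) (t z : ℕ → ℝ) (k : ℕ) : 0 ≤ ruinTerm M s u t z k := by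
  unfold ruinTerm
  split_ifs
  exacts [(Real.exp_pos _).le, le_rfl]

lemma ruinDiscount_nonneg (s : ℝ) (u : ℝ × ℝ) (t z : ℕ → ℝ) : 0 ≤ ruinDiscount M s u t z := by
  unfold ruinDiscount
  split_ifs
  exacts [zero_le_one, tsum_nonneg fun k => ruinTerm_nonneg M s u t z k]

lemma ruinDiscount_le_one {s : ℝ} (hs : 0 < s) (u : ℝ × ℝ) {t z : ℕ → ℝ} (ht : ∀ k, 0 < t k) :
    ruinDiscount M s u t z ≤ 1 := by
  unfold ruinDiscount
  split_ifs
  · exact le_rfl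
  by_cases h : ∃ k, RuinedAt M u t z k ∧ Survives M u t z k
  · obtain ⟨k, hk⟩ := h
    rw [tsum_eq_single k fun j hj => ruinTerm_eq_zero_of_ne hk hj, ruinTerm, if_pos hk,
      Real.exp_le_one_iff]
    nlinarith [clock_pos ht k]
  · push Not at h
    have : ∀ k, ruinTerm M s u t z k = 0 := fun k => if_neg fun hk => h k hk.1 hk.2
    simp [this]

end RuinDiscount

section Psi

variable (M : Params)

@[fun_prop]
lemma measurable_flow : Measurable fun q : ℝ × (ℝ × ℝ) => flow M q.1 q.2 := by
  unfold flow
  fun_prop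

@[fun_prop]
lemma measurable_payClaim : Measurable fun q : ℝ × (ℝ × ℝ) => payClaim M q.1 q.2 := by
  unfold payClaim
  fun_prop

lemma psi_of_neg [IsProbabilityMeasure (claimLaw M)] (s : ℝ) {u : ℝ × ℝ} (hu : max u.1 u.2 < 0) :
    psi M s u = 1 := by
  simp [psi, ruinDiscount, hu]

variable [IsProbabilityMeasure (claimLaw M)]

lemma abs_ruinDiscount_le {s : ℝ} (hs : 0 < s) (u : ℝ × ℝ) :
    ∀ᵐ p ∂pathLaw M, ‖ruinDiscount M s u p.1 p.2‖ ≤ 1 := by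
  filter_upwards [pathLaw_ae_pos M] with p hp
  rw [Real.norm_eq_abs, abs_of_nonneg (ruinDiscount_nonneg M s u _ _)]
  exact ruinDiscount_le_one M hs u hp.1

lemma abs_psi_le {s : ℝ} (hs : 0 < s) (u : ℝ × ℝ) : ‖psi M s u‖ ≤ 1 := by
  simpa [psi] using norm_integral_le_of_norm_le_const (abs_ruinDiscount_le M hs u)

@[fun_prop]
lemma measurable_psi (s : ℝ) : Measurable (psi M s) :=
  ((measurable_ruinDiscount M s).stronglyMeasurable.integral_prod_right (ν := pathLaw M)).measurable

/-- The renewal equation: the expected discount factor decomposed at the first claim. -/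
lemma psi_renewal {s : ℝ} (hs : 0 < s) {u : ℝ × ℝ} (hu : 0 ≤ max u.1 u.2) :
    psi M s u = ∫ x, Real.exp (-s * x) *
      ∫ w, psi M s (payClaim M w (flow M x u)) ∂claimLaw M ∂expMeasure M.lam := by
  have hm : Measurable fun p : (ℕ → ℝ) × (ℕ → ℝ) => ruinDiscount M s u p.1 p.2 :=
    (measurable_ruinDiscount M s).comp (measurable_const.prodMk measurable_id)
  rw [psi, ← (measurePreserving_cons_cons M).integral_comp_of_measurable hm]
  have hg : Measurable fun q : (ℝ × ℝ) × (ℕ → ℝ) × (ℕ → ℝ) =>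
      ruinDiscount M s (payClaim M q.1.2 (flow M q.1.1 u)) q.2.1 q.2.2 :=
    (measurable_ruinDiscount M s).comp
      (f := fun q : (ℝ × ℝ) × (ℕ → ℝ) × (ℕ → ℝ) => (payClaim M q.1.2 (flow M q.1.1 u), q.2))
      (by fun_prop)
  have hpos : ∀ᵐ q ∂((expMeasure M.lam).prod (claimLaw M)).prod (pathLaw M),
      0 < q.1.1 ∧ ∀ k, 0 < q.2.1 k :=
    (Measure.quasiMeasurePreserving_fst.ae
      (Measure.quasiMeasurePreserving_fst.ae expMeasure_ae_pos)).and
      (Measure.quasiMeasurePreserving_snd.ae ((pathLaw_ae_pos M).mono fun p hp => hp.1))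
  simp_rw [ruinDiscount_cons M s hu]
  rw [integral_prod]
  · simp_rw [integral_const_mul]
    change ∫ q : ℝ × ℝ, Real.exp (-s * q.1) * psi M s (payClaim M q.2 (flow M q.1 u))
      ∂(expMeasure M.lam).prod (claimLaw M) = _
    rw [integral_prod]
    · simp_rw [integral_const_mul]
    · refine Integrable.of_bound (Measurable.aestronglyMeasurable (by fun_prop)) 1 ?_
      filter_upwards [Measure.quasiMeasurePreserving_fst.ae (expMeasure_ae_pos (l := M.lam))]
        with q hq
      rw [norm_mul, Real.norm_eq_abs, Real.abs_exp]
      refine mul_le_one₀ (Real.exp_le_one_iff.2 (by nlinarith)) (norm_nonneg _) (abs_psi_le M hs _)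
  · refine Integrable.of_bound (Measurable.aestronglyMeasurable (by fun_prop)) 1 ?_
    filter_upwards [hpos] with q hq
    rw [norm_mul, Real.norm_eq_abs, Real.abs_exp, Real.norm_eq_abs,
      abs_of_nonneg (ruinDiscount_nonneg M s _ _ _)]
    exact mul_le_one₀ (Real.exp_le_one_iff.2 (by nlinarith [hq.1]))
      (ruinDiscount_nonneg M s _ _ _) (ruinDiscount_le_one M hs _ hq.2)

end Psi

/-- Positive inter-arrival times and divergent arrival times are all that the pathwise formula
needs, and both hold almost surely under the path law. -/
lemma PsiMax_eq_psi {Ω : Type*} [MeasurableSpace Ω] {P : Measure Ω} [IsProbabilityMeasure P]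
    {M : Params} {T σ : ℕ → Ω → ℝ} (h : IsClaimModel M P T σ) (s : ℝ) (u : ℝ × ℝ) :
    PsiMax M P T σ s u = psi M s u := by
  have := h.isProbabilityMeasure_claimLaw
  have hX : MeasurePreserving (fun ω => ((fun k => T k ω), fun k => σ k ω)) P (pathLaw M) :=
    ⟨(measurable_pi_iff.2 h.meas_T).prodMk (measurable_pi_iff.2 h.meas_σ), h.map_eq_pathLaw⟩
  have hm : Measurable fun p : (ℕ → ℝ) × (ℕ → ℝ) => ruinDiscount M s u p.1 p.2 :=
    (measurable_ruinDiscount M s).comp (measurable_const.prodMk measurable_id)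
  rw [psi, ← hX.integral_comp_of_measurable hm, PsiMax]
  refine integral_congr_ae ?_
  filter_upwards [hX.quasiMeasurePreserving.ae (pathLaw_ae_pos M),
    hX.quasiMeasurePreserving.ae (pathLaw_ae_tendsto_clock M)] with ω h1 h2
  exact expNeg_TMax M s u h1.1 h2

/-! ### Ruin as a threshold condition on the first arrival time -/

section Level

variable (M : Params)

/-- The claims `0, …, k`, discounted to the time of the first claim, when `p` lists the
inter-arrival times after the first claim and the claim sizes. -/
def claimSum (p : (ℕ → ℝ) × (ℕ → ℝ)) (k : ℕ) : ℝ :=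
  ∑ j ∈ Finset.range (k + 1), Real.exp (-M.r * elapsed p.1 j) * p.2 j

/-- The critical capital `m`: claim number `k` ruins a line with normalized capital `y` and
premium constant `b` if and only if `y < exp (-r x) * m`, where `x` is the time of the
first claim. -/
def critical (b : ℝ) (p : (ℕ → ℝ) × (ℕ → ℝ)) (k : ℕ) : ℝ :=
  claimSum M p k + b * Real.exp (-M.r * elapsed p.1 k)

/-- Claim number `k` causes joint ruin if and only if the first claim occurs before time
`gap / r`. -/
def gap (p : (ℕ → ℝ) × (ℕ → ℝ)) (k : ℕ) (y : ℝ × ℝ) : ℝ :=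
  min (Real.log (critical M M.b₁ p k) - Real.log (max y.1 y.2))
    (Real.log (critical M M.b₂ p k) - Real.log y.2)

/-- One of the first `n` claims causes joint ruin if and only if the first claim occurs before
time `level / r`. -/
def level (p : (ℕ → ℝ) × (ℕ → ℝ)) : ℕ → ℝ × ℝ → ℝ
  | 0, _ => 0
  | n + 1, y => max (level p n y) (gap M p n y)

variable {M} {p : (ℕ → ℝ) × (ℕ → ℝ)}

lemma claimSum_nonneg (hz : ∀ k, 0 < p.2 k) (k : ℕ) : 0 ≤ claimSum M p k :=
  Finset.sum_nonneg fun j _ => mul_nonneg (Real.exp_pos _).le (hz j).le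

lemma critical_pos {b : ℝ} (hb : 0 < b) (hz : ∀ k, 0 < p.2 k) (k : ℕ) : 0 < critical M b p k :=
  add_pos_of_nonneg_of_pos (claimSum_nonneg hz k) (mul_pos hb (Real.exp_pos _))

lemma critical_lt_critical {b b' : ℝ} (h : b < b') (k : ℕ) :
    critical M b p k < critical M b' p k := by
  have := Real.exp_pos (-M.r * elapsed p.1 k)
  simp only [critical]
  gcongr

lemma level_nonneg (n : ℕ) (y : ℝ × ℝ) : 0 ≤ level M p n y := by
  induction n with
  | zero => exact le_rfl
  | succ n ih => exact ih.trans (le_max_left _ _)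

lemma discClaims_cons_left (r x : ℝ) (t z : ℕ → ℝ) (k : ℕ) :
    discClaims r (cons x t) z k =
      Real.exp (-r * x) * ∑ j ∈ Finset.range (k + 1), Real.exp (-r * elapsed t j) * z j := by
  rw [discClaims, Finset.mul_sum]
  refine Finset.sum_congr rfl fun j _ => ?_
  rw [clock_cons, mul_add, Real.exp_add, mul_assoc]

/-- Both thresholds carry the factor `exp(-r x)`, so logarithms isolate `x`. Since the critical
capital for `b₂` is below that for `b₁`, the condition on `y₂` implies `y₂ < exp(-r x) m₁`; hence
`y₁` may be replaced by `max y₁ y₂`, which is positive even when `y₁` is not. -/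
lemma ruinedAt_cons_iff_lt_gap (hz : ∀ k, 0 < p.2 k) {u : ℝ × ℝ} (hu : 0 < M.y₂ u.2) (x : ℝ)
    (k : ℕ) :
    RuinedAt M u (cons x p.1) p.2 k ↔ M.r * x < gap M p k (M.y₁ u.1, M.y₂ u.2) := by
  have h1 := critical_pos (M := M) M.b₁_pos hz k
  have h2 := critical_pos (M := M) M.b₂_pos hz k
  have h12 := critical_lt_critical (M := M) (p := p) M.b₂_lt_b₁ k
  have he := Real.exp_pos (-M.r * x)
  have hform : ∀ b, discClaims M.r (cons x p.1) p.2 k +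
      b * Real.exp (-M.r * clock (cons x p.1) k) = Real.exp (-M.r * x) * critical M b p k := by
    intro b
    rw [discClaims_cons_left, clock_cons, critical, claimSum, mul_add (-M.r), Real.exp_add]
    ring
  have key : ∀ y m : ℝ, 0 < y → 0 < m →
      (M.r * x < Real.log m - Real.log y ↔ y < Real.exp (-M.r * x) * m) := by
    intro y m hy hm
    rw [← Real.log_lt_log_iff hy (mul_pos he hm), Real.log_mul he.ne' hm.ne', Real.log_exp]
    constructor <;> intro h <;> linarith
  rw [RuinedAt, hform, hform, gap, lt_min_iff, key _ _ (lt_max_of_lt_right hu) h1, key _ _ hu h2]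
  constructor
  · rintro ⟨ha, hb⟩
    exact ⟨max_lt ha (hb.trans (by gcongr)), hb⟩
  · rintro ⟨ha, hb⟩
    exact ⟨(le_max_left _ _).trans_lt ha, hb⟩

lemma survives_cons_iff_level_le (hz : ∀ k, 0 < p.2 k) {u : ℝ × ℝ} (hu : 0 < M.y₂ u.2) {x : ℝ}
    (hx : 0 ≤ x) (n : ℕ) :
    Survives M u (cons x p.1) p.2 n ↔ level M p n (M.y₁ u.1, M.y₂ u.2) / M.r ≤ x := by
  rw [div_le_iff₀' M.r_pos]
  induction n with
  | zero =>
    simp only [survives_zero, level, true_iff]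
    exact mul_nonneg M.r_pos.le hx
  | succ n ih =>
    rw [survives_succ, ih, ruinedAt_cons_iff_lt_gap hz hu, level, max_le_iff, not_lt]

/-- Ruin at claim `k` is survival of the first `k` claims minus survival of the first `k + 1`, and
each survival event is a half-line in `x`. -/
lemma ruinTerm_cons (s : ℝ) (hz : ∀ k, 0 < p.2 k) {u : ℝ × ℝ} (hu : 0 < M.y₂ u.2) {x : ℝ}
    (hx : 0 ≤ x) (k : ℕ) :
    ruinTerm M s u (cons x p.1) p.2 k = Real.exp (-s * elapsed p.1 k) *
      ((if level M p k (M.y₁ u.1, M.y₂ u.2) / M.r ≤ x then Real.exp (-s * x) else 0) -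
      (if level M p (k + 1) (M.y₁ u.1, M.y₂ u.2) / M.r ≤ x then Real.exp (-s * x) else 0)) := by
  rw [ruinTerm, clock_cons, mul_add, Real.exp_add]
  have h0 := survives_cons_iff_level_le hz hu hx k
  have h1 := survives_cons_iff_level_le hz hu hx (k + 1)
  rw [survives_succ] at h1
  by_cases hr : RuinedAt M u (cons x p.1) p.2 k <;>
    by_cases hs : Survives M u (cons x p.1) p.2 k <;>
    simp only [hr, hs, not_true_eq_false, not_false_eq_true, and_true, and_false, true_iff,
      false_iff] at h0 h1 <;>
    simp [hr, hs, h0, h1, mul_comm]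

/-- The level depends only on the sizes of the first `n` claims. -/
lemma level_update (t z : ℕ → ℝ) (w : ℝ) {i n : ℕ} (h : n ≤ i) (y : ℝ × ℝ) :
    level M (t, Function.update z i w) n y = level M (t, z) n y := by
  induction n with
  | zero => rfl
  | succ n ih =>
    have h1 : claimSum M (t, Function.update z i w) n = claimSum M (t, z) n := by
      refine Finset.sum_congr rfl fun j hj => ?_
      have : j ≠ i := by
        have := Finset.mem_range.1 hj
        omega
      simp only [Function.update_of_ne this]
    simp only [level, ih (by omega), gap, critical, h1]

lemma claimSum_update (t z : ℕ → ℝ) (w : ℝ) (i : ℕ) :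
    claimSum M (t, Function.update z i w) i =
      ∑ j ∈ Finset.range i, Real.exp (-M.r * elapsed t j) * z j +
        Real.exp (-M.r * elapsed t i) * w := by
  rw [claimSum, Finset.sum_range_succ]
  congr 1
  · refine Finset.sum_congr rfl fun j hj => ?_
    simp only [Function.update_of_ne (Finset.mem_range.1 hj).ne]
  · simp

/-- Both branches of the minimum are strictly increasing in the size of claim `i`. -/
lemma gap_update_lt (t : ℕ → ℝ) {z : ℕ → ℝ} (hz : ∀ k, 0 < z k) {w w' : ℝ} (hw : 0 < w)
    (h : w < w') (i : ℕ) (y : ℝ × ℝ) :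
    gap M (t, Function.update z i w) i y < gap M (t, Function.update z i w') i y := by
  have hR := Real.exp_pos (-M.r * elapsed t i)
  have hc : ∀ b, 0 < b → Real.log (critical M b (t, Function.update z i w) i) <
      Real.log (critical M b (t, Function.update z i w') i) := by
    intro b hb
    refine Real.log_lt_log (critical_pos hb (fun k => ?_) i) ?_
    · by_cases hk : k = i
      · subst hk; simpa using hw
      · simpa [Function.update_of_ne hk] using hz k
    · simp only [critical, claimSum_update]
      gcongr
  exact min_lt_min (by linarith [hc _ M.b₁_pos]) (by linarith [hc _ M.b₂_pos])

lemma abs_log_sub_log_le {c a b : ℝ} (hc : 0 < c) (ha : c ≤ a) (hb : c ≤ b) :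
    |Real.log a - Real.log b| ≤ |a - b| / c := by
  wlog h : b ≤ a generalizing a b
  · rw [abs_sub_comm, abs_sub_comm a]
    exact this hb ha (le_of_not_ge h)
  have hb0 : 0 < b := hc.trans_le hb
  have ha0 : 0 < a := hc.trans_le ha
  rw [abs_of_nonneg (sub_nonneg.2 (Real.log_le_log hb0 h)), abs_of_nonneg (sub_nonneg.2 h),
    ← Real.log_div ha0.ne' hb0.ne']
  calc Real.log (a / b) ≤ a / b - 1 := Real.log_le_sub_one_of_pos (by positivity)
    _ = (a - b) / b := by field_simp
    _ ≤ (a - b) / c := div_le_div_of_nonneg_left (sub_nonneg.2 h) hc hb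

/-- The logarithm is `1/c`-Lipschitz on `[c, ∞)`, and `min` and `max` do not increase Lipschitz
constants. The bound depends neither on the path nor on `k`. -/
lemma abs_gap_sub_gap_le {c : ℝ} (hc : 0 < c) {y y' : ℝ × ℝ} (hy : c ≤ y.2) (hy' : c ≤ y'.2)
    (k : ℕ) : |gap M p k y - gap M p k y'| ≤ ‖y - y'‖ / c := by
  have h1 : |y.1 - y'.1| ≤ ‖y - y'‖ := norm_fst_le (y - y')
  have h2 : |y.2 - y'.2| ≤ ‖y - y'‖ := norm_snd_le (y - y')
  refine (abs_min_sub_min_le_max _ _ _ _).trans (max_le ?_ ?_)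
  · rw [sub_sub_sub_cancel_left, abs_sub_comm]
    refine (abs_log_sub_log_le hc (le_max_of_le_right hy) (le_max_of_le_right hy')).trans ?_
    gcongr
    exact (abs_max_sub_max_le_max _ _ _ _).trans (max_le h1 h2)
  · rw [sub_sub_sub_cancel_left, abs_sub_comm]
    refine (abs_log_sub_log_le hc hy hy').trans ?_
    gcongr

lemma abs_level_sub_level_le {c : ℝ} (hc : 0 < c) {y y' : ℝ × ℝ} (hy : c ≤ y.2) (hy' : c ≤ y'.2)
    (n : ℕ) : |level M p n y - level M p n y'| ≤ ‖y - y'‖ / c := by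
  induction n with
  | zero => simpa [level] using div_nonneg (norm_nonneg (y - y')) hc.le
  | succ n ih =>
    exact (abs_max_sub_max_le_max _ _ _ _).trans (max_le ih (abs_gap_sub_gap_le hc hy hy' n))

lemma abs_exp_sub_exp_le {a b : ℝ} (ha : a ≤ 0) (hb : b ≤ 0) :
    |Real.exp a - Real.exp b| ≤ |a - b| := by
  wlog h : b ≤ a generalizing a b
  · rw [abs_sub_comm, abs_sub_comm a]
    exact this hb ha (le_of_not_ge h)
  rw [abs_of_nonneg (sub_nonneg.2 (Real.exp_le_exp.2 h)), abs_of_nonneg (sub_nonneg.2 h)]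
  have h1 : Real.exp b = Real.exp a * Real.exp (b - a) := by
    rw [← Real.exp_add]; ring_nf
  have h2 := Real.add_one_le_exp (b - a)
  have h3 := Real.exp_le_one_iff.2 ha
  have h4 := Real.exp_pos a
  have h5 : Real.exp (b - a) ≤ 1 := Real.exp_le_one_iff.2 (by linarith)
  rw [h1]
  nlinarith

end Level

/-! ### Differentiability of maxima, minima and parametric integrals -/

section Differentiability

variable {E : Type*} [NormedAddCommGroup E] [NormedSpace ℝ E]

lemma _root_.DifferentiableAt.max_of_ne {f g : E → ℝ} {x : E} (hf : DifferentiableAt ℝ f x)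
    (hg : DifferentiableAt ℝ g x) (h : f x ≠ g x) :
    DifferentiableAt ℝ (fun y => max (f y) (g y)) x := by
  rcases lt_or_gt_of_ne h with h | h
  · refine hg.congr_of_eventuallyEq ?_
    filter_upwards [hf.continuousAt.eventually_lt hg.continuousAt h] with y hy
    exact max_eq_right hy.le
  · refine hf.congr_of_eventuallyEq ?_
    filter_upwards [hg.continuousAt.eventually_lt hf.continuousAt h] with y hy
    exact max_eq_left hy.le

lemma _root_.DifferentiableAt.min_of_ne {f g : E → ℝ} {x : E} (hf : DifferentiableAt ℝ f x)
    (hg : DifferentiableAt ℝ g x) (h : f x ≠ g x) :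
    DifferentiableAt ℝ (fun y => min (f y) (g y)) x := by
  rcases lt_or_gt_of_ne h with h | h
  · refine hf.congr_of_eventuallyEq ?_
    filter_upwards [hf.continuousAt.eventually_lt hg.continuousAt h] with y hy
    exact min_eq_left hy.le
  · refine hg.congr_of_eventuallyEq ?_
    filter_upwards [hg.continuousAt.eventually_lt hf.continuousAt h] with y hy
    exact min_eq_right hy.le

/-- Differentiation under the integral sign, for Lipschitz integrands that are differentiable
at the point almost surely. -/
lemma differentiableAt_integral_of_lipschitz {α : Type*} [MeasurableSpace α] {μ : Measure α}
    {F : ℝ × ℝ → α → ℝ} {x₀ : ℝ × ℝ} {s : Set (ℝ × ℝ)} {bound : α → ℝ} (hs : s ∈ 𝓝 x₀)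
    (hF : ∀ x, Measurable (F x)) (hint : Integrable (F x₀) μ)
    (hlip : ∀ᵐ a ∂μ, ∀ x ∈ s, |F x a - F x₀ a| ≤ bound a * ‖x - x₀‖)
    (hbound : Integrable bound μ) (hdiff : ∀ᵐ a ∂μ, DifferentiableAt ℝ (fun x => F x a) x₀) :
    DifferentiableAt ℝ (fun x => ∫ a, F x a ∂μ) x₀ := by
  set F' : α → ℝ × ℝ →L[ℝ] ℝ := fun a => fderiv ℝ (fun x => F x a) x₀ with hF'
  -- Measurability of the derivative: in a fixed direction it is a limit of measurable difference
  -- quotients, and two directions determine it.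
  have hdir : ∀ v, AEMeasurable (fun a => F' a v) μ := by
    intro v
    refine aemeasurable_of_tendsto_metrizable_ae atTop
      (f := fun (n : ℕ) a => (n : ℝ) • (F (x₀ + (n : ℝ)⁻¹ • v) a - F x₀ a))
      (fun n => (((hF _).sub (hF _)).const_smul (n : ℝ)).aemeasurable) ?_
    filter_upwards [hdiff] with a ha
    refine ha.hasFDerivAt.lim v (c := fun n : ℕ => (n : ℝ)) ?_
    simpa using tendsto_natCast_atTop_atTop (R := ℝ)
  have hmeas : AEStronglyMeasurable F' μ := by
    have h : F' = fun a => F' a (1, 0) • ContinuousLinearMap.fst ℝ ℝ ℝ +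
        F' a (0, 1) • ContinuousLinearMap.snd ℝ ℝ ℝ := by
      funext a
      ext <;> simp
    rw [h]
    exact ((hdir _).aestronglyMeasurable.smul_const _).add
      ((hdir _).aestronglyMeasurable.smul_const _)
  exact (hasFDerivAt_integral_of_dominated_loc_of_lip' hs
    (fun x _ => (hF x).aestronglyMeasurable) hint hmeas (by simpa using hlip) hbound
    (hdiff.mono fun a ha => ha.hasFDerivAt)).2.differentiableAt

end Differentiability

/-! ### Differentiability of the Laplace transform through a series over the ruining claim -/

section Series

variable (M : Params)

@[fun_prop]
lemma measurable_critical (b : ℝ) (k : ℕ) : Measurable fun p => critical M b p k := by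
  unfold critical claimSum
  fun_prop

@[fun_prop]
lemma measurable_gap (k : ℕ) (y : ℝ × ℝ) : Measurable fun p => gap M p k y := by
  unfold gap
  exact Measurable.min (((measurable_critical M _ k).log).sub_const _)
    (((measurable_critical M _ k).log).sub_const _)

@[fun_prop]
lemma measurable_level (n : ℕ) (y : ℝ × ℝ) : Measurable fun p => level M p n y := by
  induction n with
  | zero => exact measurable_const
  | succ n ih => exact ih.max (measurable_gap M n y)

variable [IsProbabilityMeasure (claimLaw M)]

/-- A quantity that is injective in the size of one of the claims does not vanish,
almost surely. -/
lemma ae_ne_zero_of_update (i : ℕ) {F : (ℕ → ℝ) × (ℕ → ℝ) → ℝ} (hF : Measurable F)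
    (h : ∀ t z : ℕ → ℝ, (∀ k, 0 < z k) → ∀ w w', 0 < w → w < w' →
      F (t, Function.update z i w) = 0 → F (t, Function.update z i w') ≠ 0) :
    ∀ᵐ p ∂pathLaw M, F p ≠ 0 := by
  have hmp := (measurePreserving_update_snd M i).comp
    (Measure.measurePreserving_swap (μ := pathLaw M) (ν := claimLaw M))
  have hset : MeasurableSet {p | F p ≠ 0} := (hF (measurableSet_singleton 0)).compl
  -- After resampling claim `i`, Fubini reduces the assertion to frozen remaining data. At most one
  -- positive size is then bad, a null set for a law with a density.
  rw [← hmp.map_eq, ae_map_iff hmp.measurable.aemeasurable hset]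
  refine (Measure.ae_prod_iff_ae_ae (hmp.measurable hset)).2 ?_
  filter_upwards [pathLaw_ae_pos M] with p hp
  have hsub : {w : ℝ | 0 < w ∧ F (p.1, Function.update p.2 i w) = 0}.Subsingleton := by
    rintro w ⟨hw, hFw⟩ w' ⟨hw', hFw'⟩
    rcases lt_trichotomy w w' with hlt | heq | hlt
    · exact absurd hFw' (h _ _ hp.2 _ _ hw hlt hFw)
    · exact heq
    · exact absurd hFw (h _ _ hp.2 _ _ hw' hlt hFw')
  have hnull : claimLaw M {w : ℝ | 0 < w ∧ F (p.1, Function.update p.2 i w) = 0} = 0 :=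
    claimLaw_absolutelyContinuous M (hsub.measure_zero volume)
  filter_upwards [measure_eq_zero_iff_ae_notMem.1 hnull, claimLaw_ae_pos M] with w hw1 hw2 hw3
  exact hw1 ⟨hw2, hw3⟩

/-- `level k` involves only the claims before number `k`, while `gap k` strictly increases with the
size of claim `k`; a tie fixes that size. -/
lemma ae_level_ne_gap (k : ℕ) (y : ℝ × ℝ) : ∀ᵐ p ∂pathLaw M, level M p k y ≠ gap M p k y := by
  have h := ae_ne_zero_of_update M k
    (F := fun p => level M p k y - gap M p k y) (by fun_prop) ?_
  · filter_upwards [h] with p hp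
    exact sub_ne_zero.1 hp
  · intro t z hz w w' hw hlt h1 h2
    rw [level_update _ _ _ le_rfl] at h1 h2
    have := gap_update_lt (M := M) t hz hw hlt k y
    linarith

/-- A tie means `m₁ y₂ = m₂ y₁` for the critical capitals. The difference is affine in the size of
claim `k`, with slope a nonzero multiple of `y₂ - y₁`. -/
lemma ae_branches_ne (k : ℕ) {y : ℝ × ℝ} (h2 : 0 < y.2) (h12 : y.2 < y.1) :
    ∀ᵐ p ∂pathLaw M, Real.log (critical M M.b₁ p k) - Real.log y.1 ≠
      Real.log (critical M M.b₂ p k) - Real.log y.2 := by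
  have h := ae_ne_zero_of_update M k
    (F := fun p => critical M M.b₁ p k * y.2 - critical M M.b₂ p k * y.1) (by fun_prop) ?_
  · filter_upwards [h, pathLaw_ae_pos M] with p hp hpos heq
    have hm1 := critical_pos (M := M) M.b₁_pos hpos.2 k
    have hm2 := critical_pos (M := M) M.b₂_pos hpos.2 k
    have h1 : 0 < y.1 := h2.trans h12
    rw [← Real.log_div hm1.ne' h1.ne', ← Real.log_div hm2.ne' h2.ne'] at heq
    have := Real.log_injOn_pos (div_pos hm1 h1) (div_pos hm2 h2) heq
    rw [div_eq_div_iff h1.ne' h2.ne'] at this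
    exact hp (by linarith)
  · intro t z hz w w' hw hlt h3 h4
    simp only [critical, claimSum_update] at h3 h4
    have hR := Real.exp_pos (-M.r * elapsed t k)
    have : Real.exp (-M.r * elapsed t k) * ((w' - w) * (y.1 - y.2)) = 0 := by linarith
    have h5 : 0 < (w' - w) * (y.1 - y.2) := mul_pos (sub_pos.2 hlt) (sub_pos.2 h12)
    exact (mul_pos hR h5).ne' this

/-- For `y₁ ≤ y₂` the second branch is strictly smaller, because `m₂ < m₁`, so the kink of `max y₁
y₂` on the diagonal is never seen. For `y₁ > y₂` the gap is locally a minimum of two smooth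
branches, which almost surely differ. -/
lemma ae_differentiableAt_gap (k : ℕ) {y : ℝ × ℝ} (h2 : 0 < y.2) :
    ∀ᵐ p ∂pathLaw M, DifferentiableAt ℝ (gap M p k) y := by
  have hd2 : ∀ a : ℝ, DifferentiableAt ℝ (fun y : ℝ × ℝ => a - Real.log y.2) y := fun a =>
    (differentiableAt_snd.log h2.ne').const_sub a
  rcases le_or_gt y.1 y.2 with h | h
  · filter_upwards [pathLaw_ae_pos M] with p hp
    refine (hd2 (Real.log (critical M M.b₂ p k))).congr_of_eventuallyEq ?_
    have hlt : Real.log (critical M M.b₂ p k) - Real.log y.2 <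
        Real.log (critical M M.b₁ p k) - Real.log (max y.1 y.2) := by
      rw [max_eq_right h]
      have := Real.log_lt_log (critical_pos (M := M) M.b₂_pos hp.2 k)
        (critical_lt_critical (M := M) (p := p) M.b₂_lt_b₁ k)
      linarith
    have hc : ContinuousAt (fun y : ℝ × ℝ => Real.log (critical M M.b₁ p k) -
        Real.log (max y.1 y.2)) y :=
      continuousAt_const.sub ((by fun_prop : Continuous fun y : ℝ × ℝ =>
        max y.1 y.2).continuousAt.log (lt_max_of_lt_right h2).ne')
    filter_upwards [(hd2 _).continuousAt.eventually_lt hc hlt] with y' hy'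
    exact min_eq_right hy'.le
  · filter_upwards [ae_branches_ne M k h2 h] with p hp
    have hd1 : DifferentiableAt ℝ (fun y : ℝ × ℝ => Real.log (critical M M.b₁ p k) -
        Real.log y.1) y := (differentiableAt_fst.log (h2.trans h).ne').const_sub _
    refine (hd1.min_of_ne (hd2 _) hp).congr_of_eventuallyEq ?_
    filter_upwards [continuousAt_snd.eventually_lt continuousAt_fst h] with y' hy'
    rw [gap, max_eq_left hy'.le]

lemma ae_differentiableAt_level (n : ℕ) {y : ℝ × ℝ} (h2 : 0 < y.2) :
    ∀ᵐ p ∂pathLaw M, DifferentiableAt ℝ (level M p n) y := by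
  induction n with
  | zero => exact ae_of_all _ fun p => differentiableAt_const 0
  | succ n ih =>
    filter_upwards [ih, ae_differentiableAt_gap M n h2, ae_level_ne_gap M n y] with p h1 h2 h3
    exact h1.max_of_ne h2 h3

/-- The discount factor of claim number `k` relative to the first claim, averaged over the event
that the first `n` claims do not cause joint ruin. -/
def survivalMean (s : ℝ) (k n : ℕ) (y : ℝ × ℝ) : ℝ :=
  ∫ p, Real.exp (-s * elapsed p.1 k) * Real.exp (-((M.lam + s) / M.r) * level M p n y) ∂pathLaw M

omit [IsProbabilityMeasure (claimLaw M)] in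
lemma abs_survival_sub_le {s : ℝ} (hs : 0 < s) (k n : ℕ) {c : ℝ} (hc : 0 < c) {y y' : ℝ × ℝ}
    (hy : c ≤ y.2) (hy' : c ≤ y'.2) (p : (ℕ → ℝ) × (ℕ → ℝ)) :
    |Real.exp (-s * elapsed p.1 k) * Real.exp (-((M.lam + s) / M.r) * level M p n y) -
      Real.exp (-s * elapsed p.1 k) * Real.exp (-((M.lam + s) / M.r) * level M p n y')| ≤
      Real.exp (-s * elapsed p.1 k) * ((M.lam + s) / M.r / c) * ‖y - y'‖ := by
  have hp : 0 < (M.lam + s) / M.r := div_pos (add_pos M.lam_pos hs) M.r_pos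
  rw [← mul_sub, abs_mul, Real.abs_exp, mul_assoc]
  gcongr
  have h1 := level_nonneg (M := M) (p := p) n y
  have h2 := level_nonneg (M := M) (p := p) n y'
  refine (abs_exp_sub_exp_le (by nlinarith) (by nlinarith)).trans ?_
  rw [← mul_sub, abs_mul, abs_neg, abs_of_pos hp, div_mul_eq_mul_div _ c, mul_div_assoc _ _ c]
  gcongr
  exact abs_level_sub_level_le hc hy hy' n

lemma integrable_survival {s : ℝ} (hs : 0 < s) (k n : ℕ) (y : ℝ × ℝ) :
    Integrable (fun p => Real.exp (-s * elapsed p.1 k) *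
      Real.exp (-((M.lam + s) / M.r) * level M p n y)) (pathLaw M) := by
  have hp : 0 < (M.lam + s) / M.r := div_pos (add_pos M.lam_pos hs) M.r_pos
  refine (integrable_exp_elapsed M hs k).mono'
    (Measurable.aestronglyMeasurable (by fun_prop)) (ae_of_all _ fun p => ?_)
  rw [norm_mul, Real.norm_eq_abs, Real.norm_eq_abs, Real.abs_exp, Real.abs_exp]
  refine mul_le_of_le_one_right (Real.exp_pos _).le (Real.exp_le_one_iff.2 ?_)
  nlinarith [level_nonneg (M := M) (p := p) n y]

lemma differentiableAt_survivalMean {s : ℝ} (hs : 0 < s) (k n : ℕ) {y : ℝ × ℝ} (hy : 0 < y.2) :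
    DifferentiableAt ℝ (survivalMean M s k n) y := by
  -- On `y'.2 > y.2 / 2` the level is Lipschitz with constant `1 / (y.2 / 2)`, uniformly over paths.
  refine differentiableAt_integral_of_lipschitz (s := {y' | y.2 / 2 < y'.2})
    (bound := fun p => Real.exp (-s * elapsed p.1 k) * ((M.lam + s) / M.r / (y.2 / 2)))
    ((isOpen_lt continuous_const continuous_snd).mem_nhds (by simpa using half_lt_self hy))
    (fun y => by fun_prop) (integrable_survival M hs k n y) (ae_of_all _ fun p y' hy' => ?_)
    ((integrable_exp_elapsed M hs k).mul_const _) ?_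
  · exact abs_survival_sub_le M hs k n (half_pos hy) (le_of_lt hy') (half_le_self hy.le) p
  · filter_upwards [ae_differentiableAt_level M n hy] with p hp
    exact ((hp.const_mul _).exp).const_mul _

lemma abs_survivalMean_sub_le {s : ℝ} (hs : 0 < s) (k n : ℕ) {c : ℝ} (hc : 0 < c) {y y' : ℝ × ℝ}
    (hy : c ≤ y.2) (hy' : c ≤ y'.2) :
    |survivalMean M s k n y - survivalMean M s k n y'| ≤
      (M.lam / (M.lam + s)) ^ k * ((M.lam + s) / M.r / c) * ‖y - y'‖ := by
  rw [survivalMean, survivalMean, ← integral_sub (integrable_survival M hs k n y)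
    (integrable_survival M hs k n y'), ← integral_exp_elapsed M hs k, ← integral_mul_const,
    ← integral_mul_const, ← Real.norm_eq_abs]
  exact norm_integral_le_of_norm_le (((integrable_exp_elapsed M hs k).mul_const _).mul_const _)
    (ae_of_all _ fun p => abs_survival_sub_le M hs k n hc hy hy' p)

lemma survivalMean_mem {s : ℝ} (hs : 0 < s) (k n : ℕ) (y : ℝ × ℝ) :
    survivalMean M s k n y ∈ Set.Icc 0 ((M.lam / (M.lam + s)) ^ k) := by
  have hp : 0 < (M.lam + s) / M.r := div_pos (add_pos M.lam_pos hs) M.r_pos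
  constructor
  · exact integral_nonneg fun p => by positivity
  · rw [← integral_exp_elapsed M hs k]
    refine integral_mono (integrable_survival M hs k n y) (integrable_exp_elapsed M hs k)
      fun p => ?_
    refine mul_le_of_le_one_right (Real.exp_pos _).le (Real.exp_le_one_iff.2 ?_)
    nlinarith [level_nonneg (M := M) (p := p) n y]

lemma integral_ruinTerm {s : ℝ} (hs : 0 < s) {u : ℝ × ℝ} (hu : 0 < M.y₂ u.2) (k : ℕ) :
    ∫ p, ruinTerm M s u p.1 p.2 k ∂pathLaw M = M.lam / (M.lam + s) *
      (survivalMean M s k k (M.y₁ u.1, M.y₂ u.2) -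
        survivalMean M s k (k + 1) (M.y₁ u.1, M.y₂ u.2)) := by
  have hm : Measurable fun p : (ℕ → ℝ) × (ℕ → ℝ) => ruinTerm M s u p.1 p.2 k :=
    (measurable_ruinTerm M s k).comp (measurable_const.prodMk measurable_id)
  -- The swap makes the first inter-arrival time the inner variable, so that it is integrated first
  -- with the rest of the path fixed.
  have hmp := (measurePreserving_cons_fst M).comp
    (Measure.measurePreserving_swap (μ := pathLaw M) (ν := expMeasure M.lam))
  rw [← hmp.integral_comp_of_measurable hm]
  have hint : Integrable (fun q : ((ℕ → ℝ) × (ℕ → ℝ)) × ℝ => ruinTerm M s u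
      (cons q.2 q.1.1) q.1.2 k) ((pathLaw M).prod (expMeasure M.lam)) := by
    refine Integrable.of_bound (hm.comp hmp.measurable).aestronglyMeasurable 1 ?_
    filter_upwards [hmp.quasiMeasurePreserving.ae (pathLaw_ae_pos M)] with q hq
    rw [Real.norm_eq_abs, abs_of_nonneg (ruinTerm_nonneg _ _ _ _ _ _), ruinTerm]
    split_ifs
    · rw [Real.exp_le_one_iff]
      have := clock_pos hq.1 k
      simp only [Function.comp_apply, Prod.fst_swap, Prod.snd_swap] at this
      nlinarith
    · exact zero_le_one
  have hint' : ∀ a, Integrable (fun x => if a ≤ x then Real.exp (-s * x) else 0)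
      (expMeasure M.lam) := by
    intro a
    refine Integrable.of_bound (Measurable.ite measurableSet_Ici
      (by fun_prop) measurable_const).aestronglyMeasurable 1 ?_
    filter_upwards [expMeasure_ae_pos] with x hx
    split_ifs
    · rw [Real.norm_eq_abs, Real.abs_exp, Real.exp_le_one_iff]
      nlinarith
    · simp
  simp only [Function.comp_apply, Prod.fst_swap, Prod.snd_swap]
  rw [integral_prod _ hint, survivalMean, survivalMean,
    ← integral_sub (integrable_survival M hs _ _ _) (integrable_survival M hs _ _ _),
    ← integral_const_mul]
  refine integral_congr_ae ?_
  filter_upwards [pathLaw_ae_pos M] with p hp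
  have hlev : ∀ n, 0 ≤ level M p n (M.y₁ u.1, M.y₂ u.2) / M.r :=
    fun n => div_nonneg (level_nonneg n _) M.r_pos.le
  have hexp : ∀ n, Real.exp (-(M.lam + s) * (level M p n (M.y₁ u.1, M.y₂ u.2) / M.r)) =
      Real.exp (-((M.lam + s) / M.r) * level M p n (M.y₁ u.1, M.y₂ u.2)) := by
    intro n
    congr 1
    ring
  have h1 : ∫ x, ruinTerm M s u (cons x p.1) p.2 k ∂expMeasure M.lam =
      ∫ x, Real.exp (-s * elapsed p.1 k) *
      ((if level M p k (M.y₁ u.1, M.y₂ u.2) / M.r ≤ x then Real.exp (-s * x) else 0) -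
      (if level M p (k + 1) (M.y₁ u.1, M.y₂ u.2) / M.r ≤ x then Real.exp (-s * x) else 0))
      ∂expMeasure M.lam := by
    refine integral_congr_ae ?_
    filter_upwards [expMeasure_ae_pos] with x hx
    exact ruinTerm_cons s hp.2 hu hx.le k
  rw [h1, integral_const_mul, integral_sub (hint' _) (hint' _),
    integral_expMeasure_exp_ite M.lam_pos hs (hlev _),
    integral_expMeasure_exp_ite M.lam_pos hs (hlev _), hexp, hexp]
  ring

/-- The series representation of the Laplace transform of the joint ruin time, as a function of
the normalized capitals. -/
def psiSeries (s : ℝ) (y : ℝ × ℝ) : ℝ :=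
  ∑' k, M.lam / (M.lam + s) * (survivalMean M s k k y - survivalMean M s k (k + 1) y)

omit [IsProbabilityMeasure (claimLaw M)] in
lemma ratio_lt_one {s : ℝ} (hs : 0 < s) : M.lam / (M.lam + s) < 1 := by
  rw [div_lt_one (add_pos M.lam_pos hs)]
  linarith

omit [IsProbabilityMeasure (claimLaw M)] in
lemma ratio_nonneg {s : ℝ} (hs : 0 < s) : 0 ≤ M.lam / (M.lam + s) :=
  div_nonneg M.lam_pos.le (add_pos M.lam_pos hs).le

lemma abs_series_term_le {s : ℝ} (hs : 0 < s) (k : ℕ) (y : ℝ × ℝ) :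
    |M.lam / (M.lam + s) * (survivalMean M s k k y - survivalMean M s k (k + 1) y)| ≤
      (M.lam / (M.lam + s)) ^ k := by
  rw [abs_mul, abs_of_nonneg (ratio_nonneg M hs)]
  refine (mul_le_of_le_one_left (abs_nonneg _) (ratio_lt_one M hs).le).trans ?_
  have h1 := survivalMean_mem M hs k k y
  have h2 := survivalMean_mem M hs k (k + 1) y
  rw [abs_le]
  constructor <;> linarith [h1.1, h1.2, h2.1, h2.2]

/-- Term `k` is Lipschitz with a constant proportional to `(λ/(λ+s))^k` on a half-plane around `y`,
which bounds the derivatives by a geometric series and permits termwise differentiation. -/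
lemma differentiableAt_psiSeries {s : ℝ} (hs : 0 < s) {y : ℝ × ℝ} (hy : 0 < y.2) :
    DifferentiableAt ℝ (psiSeries M s) y := by
  set q := M.lam / (M.lam + s) with hq
  have hq0 := ratio_nonneg M hs
  have hq1 := ratio_lt_one M hs
  have hgeo := summable_geometric_of_lt_one hq0 hq1
  set f : ℕ → ℝ × ℝ → ℝ := fun k y =>
    q * (survivalMean M s k k y - survivalMean M s k (k + 1) y) with hf
  set S : Set (ℝ × ℝ) := {y' | y.2 / 2 < y'.2} with hS
  have hopen : IsOpen S := isOpen_lt continuous_const continuous_snd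
  have hy2 : 0 < y.2 / 2 := half_pos hy
  have hd : ∀ k, ∀ x ∈ S, DifferentiableAt ℝ (f k) x := fun k x hx =>
    ((differentiableAt_survivalMean M hs k k (hy2.trans hx)).sub
      (differentiableAt_survivalMean M hs k (k + 1) (hy2.trans hx))).const_mul _
  have hL : 0 ≤ (M.lam + s) / M.r / (y.2 / 2) :=
    div_nonneg (div_pos (add_pos M.lam_pos hs) M.r_pos).le hy2.le
  have hbound : ∀ k, ∀ x ∈ S, ‖fderiv ℝ (f k) x‖ ≤
      q ^ k * (2 * ((M.lam + s) / M.r / (y.2 / 2))) := by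
    intro k x hx
    refine norm_fderiv_le_of_lip' ℝ (by positivity) ?_
    filter_upwards [hopen.mem_nhds hx] with x' hx'
    have h1 := abs_survivalMean_sub_le M hs k k hy2 (le_of_lt hx') (le_of_lt hx)
    have h2 := abs_survivalMean_sub_le M hs k (k + 1) hy2 (le_of_lt hx') (le_of_lt hx)
    simp only [hf, ← mul_sub]
    rw [norm_mul, Real.norm_eq_abs, abs_of_nonneg hq0, Real.norm_eq_abs]
    refine (mul_le_of_le_one_left (abs_nonneg _) hq1.le).trans ?_
    rw [abs_le] at h1 h2 ⊢
    constructor <;> linarith [h1.1, h1.2, h2.1, h2.2]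
  have hconv : Convex ℝ S := by
    have : S = (LinearMap.snd ℝ ℝ ℝ) ⁻¹' Set.Ioi (y.2 / 2) := rfl
    rw [this]
    exact (convex_Ioi _).linear_preimage _
  have hyS : y ∈ S := half_lt_self hy
  exact (hasFDerivAt_tsum_of_isPreconnected (hgeo.mul_right _) hopen hconv.isPreconnected
    (fun k x hx => (hd k x hx).hasFDerivAt) hbound hyS
    (Summable.of_norm_bounded hgeo fun k => abs_series_term_le M hs k y) hyS).differentiableAt

lemma psi_eq_psiSeries {s : ℝ} (hs : 0 < s) {u : ℝ × ℝ} (hu : 0 ≤ max u.1 u.2)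
    (hu2 : 0 < M.y₂ u.2) : psi M s u = psiSeries M s (M.y₁ u.1, M.y₂ u.2) := by
  have hm : ∀ k, Measurable fun p : (ℕ → ℝ) × (ℕ → ℝ) => ruinTerm M s u p.1 p.2 k := fun k =>
    (measurable_ruinTerm M s k).comp (measurable_const.prodMk measurable_id)
  have hint : ∀ k, Integrable (fun p : (ℕ → ℝ) × (ℕ → ℝ) => ruinTerm M s u p.1 p.2 k)
      (pathLaw M) := by
    intro k
    refine Integrable.of_bound (hm k).aestronglyMeasurable 1 ?_
    filter_upwards [pathLaw_ae_pos M] with p hp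
    rw [Real.norm_eq_abs, abs_of_nonneg (ruinTerm_nonneg _ _ _ _ _ _), ruinTerm]
    split_ifs
    · rw [Real.exp_le_one_iff]
      nlinarith [clock_pos hp.1 k]
    · exact zero_le_one
  have hsum : Summable fun k => ∫ p, ‖ruinTerm M s u p.1 p.2 k‖ ∂pathLaw M := by
    have : ∀ k, ∫ p, ‖ruinTerm M s u p.1 p.2 k‖ ∂pathLaw M =
        M.lam / (M.lam + s) * (survivalMean M s k k (M.y₁ u.1, M.y₂ u.2) -
        survivalMean M s k (k + 1) (M.y₁ u.1, M.y₂ u.2)) := by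
      intro k
      rw [← integral_ruinTerm M hs hu2]
      refine integral_congr_ae (ae_of_all _ fun p => ?_)
      exact abs_of_nonneg (ruinTerm_nonneg _ _ _ _ _ _)
    simp_rw [this]
    exact Summable.of_norm_bounded (summable_geometric_of_lt_one (ratio_nonneg M hs)
      (ratio_lt_one M hs)) fun k => abs_series_term_le M hs k _
  have h := hasSum_integral_of_summable_integral_norm hint hsum
  simp_rw [integral_ruinTerm M hs hu2] at h
  rw [psiSeries, h.tsum_eq, psi]
  refine integral_congr_ae (ae_of_all _ fun p => ?_)
  simp only [ruinDiscount, if_neg hu.not_gt]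

/-- On the part of the plane where joint ruin has not occurred, the Laplace transform is the
restriction of a differentiable function. -/
lemma exists_differentiableAt_eq_psi {s : ℝ} (hs : 0 < s) :
    ∃ g : ℝ × ℝ → ℝ, (∀ u : ℝ × ℝ, 0 < M.y₂ u.2 → DifferentiableAt ℝ g u) ∧
      ∀ u : ℝ × ℝ, 0 ≤ max u.1 u.2 → 0 < M.y₂ u.2 → psi M s u = g u := by
  refine ⟨fun u => psiSeries M s (M.y₁ u.1, M.y₂ u.2), fun u hu => ?_,
    fun u hu hu2 => psi_eq_psiSeries M hs hu hu2⟩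
  have h : DifferentiableAt ℝ (fun u : ℝ × ℝ => (M.y₁ u.1, M.y₂ u.2)) u := by
    unfold Params.y₁ Params.y₂
    fun_prop
  exact (differentiableAt_psiSeries M hs (y := (M.y₁ u.1, M.y₂ u.2)) hu).comp u h

end Series

/-! ### Geometry of the domain and the derivative along the flow -/

section Geometry

variable {M : Params}

lemma mem_liveDomain_iff {u : ℝ × ℝ} : u ∈ liveDomain M ↔ u ∈ domain M ∧ 0 ≤ u.2 := by
  refine and_congr_right fun h => ⟨fun h0 => ?_, fun h0 => le_max_of_le_right h0⟩
  by_contra hneg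
  push Not at hneg
  have h2 : u.2 / M.δ₂ < 0 := div_neg_of_neg_of_pos hneg M.δ₂_pos
  have h1 : u.1 < 0 := neg_of_div_neg_left (lt_of_le_of_lt h h2) M.δ₁_pos.le
  exact absurd h0 (not_le.2 (max_lt h1 hneg))

lemma neg_of_mem_domain {u : ℝ × ℝ} (h : u ∈ domain M) (h2 : u.2 < 0) : u.1 < 0 :=
  neg_of_div_neg_left (lt_of_le_of_lt h (div_neg_of_neg_of_pos h2 M.δ₂_pos)) M.δ₁_pos.le

lemma Params.y₂_pos {u : ℝ × ℝ} (hu : 0 ≤ u.2) : 0 < M.y₂ u.2 :=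
  add_pos_of_nonneg_of_pos (div_nonneg hu M.δ₂_pos.le) M.b₂_pos

lemma payClaim_mem_domain {u : ℝ × ℝ} (hu : u ∈ domain M) (w : ℝ) :
    payClaim M w u ∈ domain M := by
  have := M.δ₁_pos
  have := M.δ₂_pos
  have h1 : (u.1 - M.δ₁ * w) / M.δ₁ = u.1 / M.δ₁ - w := by field_simp
  have h2 : (u.2 - M.δ₂ * w) / M.δ₂ = u.2 / M.δ₂ - w := by field_simp
  have hu' : u.1 / M.δ₁ ≤ u.2 / M.δ₂ := hu
  change (u.1 - M.δ₁ * w) / M.δ₁ ≤ (u.2 - M.δ₂ * w) / M.δ₂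
  rw [h1, h2]
  linarith

lemma flow_zero (u : ℝ × ℝ) : flow M 0 u = u := by
  simp [flow]

lemma flow_flow (x x' : ℝ) (u : ℝ × ℝ) : flow M x (flow M x' u) = flow M (x + x') u := by
  simp only [flow, mul_add, Real.exp_add]
  ext <;> ring

lemma continuous_flow (u : ℝ × ℝ) : Continuous fun x => flow M x u := by
  unfold flow
  fun_prop

lemma continuous_payClaim (w : ℝ) : Continuous (payClaim M w) := by
  unfold payClaim
  fun_prop

lemma flow_snd_nonneg {x : ℝ} (hx : 0 ≤ x) {u : ℝ × ℝ} (hu : 0 ≤ u.2) : 0 ≤ (flow M x u).2 := by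
  have h1 : 1 ≤ Real.exp (M.r * x) := Real.one_le_exp (mul_nonneg M.r_pos.le hx)
  have h2 : 0 < M.c₂ / M.r := div_pos M.c₂_pos M.r_pos
  simp only [flow]
  nlinarith

lemma hasDerivAt_flow (x : ℝ) (u : ℝ × ℝ) :
    HasDerivAt (fun x => flow M x u) (M.r * ((flow M x u).1 + M.c₁ / M.r),
      M.r * ((flow M x u).2 + M.c₂ / M.r)) x := by
  have he : HasDerivAt (fun x => Real.exp (M.r * x)) (Real.exp (M.r * x) * M.r) x := by
    simpa using ((hasDerivAt_id x).const_mul M.r).exp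
  have h1 := ((he.mul_const (u.1 + M.c₁ / M.r)).sub_const (M.c₁ / M.r)).prodMk
    ((he.mul_const (u.2 + M.c₂ / M.r)).sub_const (M.c₂ / M.r))
  refine h1.congr_deriv ?_
  refine Prod.ext ?_ ?_ <;> simp only [flow] <;> ring

/-- This locates the flow relative to the ray. With `y₁ ≤ y₂` it stays in the domain for ever;
otherwise it reaches the ray when `exp(r x) (y₁ - y₂) = b₁ - b₂`. -/
lemma flow_div_sub_div (x : ℝ) (u : ℝ × ℝ) :
    (flow M x u).1 / M.δ₁ - (flow M x u).2 / M.δ₂ =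
      Real.exp (M.r * x) * (M.y₁ u.1 - M.y₂ u.2) - (M.b₁ - M.b₂) := by
  have := M.r_pos
  have := M.δ₁_pos
  have := M.δ₂_pos
  simp only [flow, Params.y₁, Params.y₂, Params.b₁, Params.b₂]
  field_simp
  ring

/-- The horizontal slice of the live domain is a half-line containing the point, so the one-sided
partial derivative is unique even on the boundary and is read off from the Fréchet derivative. -/
lemma partialFst_eq {g : ℝ × ℝ → ℝ} {L : ℝ × ℝ →L[ℝ] ℝ} {u : ℝ × ℝ} (hu : u ∈ liveDomain M)
    (h : HasFDerivWithinAt g L (liveDomain M) u) : partialFst g (liveDomain M) u = L (1, 0) := by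
  have hu' := mem_liveDomain_iff.1 hu
  have hset : {v | (v, u.2) ∈ liveDomain M} = Set.Iic (u.2 / M.δ₂ * M.δ₁) := by
    ext v
    change (v, u.2) ∈ liveDomain M ↔ _
    rw [mem_liveDomain_iff, Set.mem_Iic, ← div_le_iff₀ M.δ₁_pos]
    exact and_iff_left hu'.2
  have hmem : u.1 ∈ Set.Iic (u.2 / M.δ₂ * M.δ₁) := (div_le_iff₀ M.δ₁_pos).1 hu'.1
  have hd : HasDerivWithinAt (fun v : ℝ => (v, u.2)) (1, 0) {v | (v, u.2) ∈ liveDomain M} u.1 :=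
    (hasDerivWithinAt_id _ _).prodMk (hasDerivWithinAt_const _ _ _)
  have h1 : HasDerivWithinAt (fun v => g (v, u.2)) (L (1, 0))
      {v | (v, u.2) ∈ liveDomain M} u.1 :=
    HasFDerivWithinAt.comp_hasDerivWithinAt u.1 (t := liveDomain M) h hd fun _ hv => hv
  refine h1.derivWithin ?_
  rw [hset]
  exact uniqueDiffOn_Iic _ _ hmem

lemma partialSnd_eq {g : ℝ × ℝ → ℝ} {L : ℝ × ℝ →L[ℝ] ℝ} {u : ℝ × ℝ} (hu : u ∈ liveDomain M)
    (h : HasFDerivWithinAt g L (liveDomain M) u) : partialSnd g (liveDomain M) u = L (0, 1) := by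
  have hu' := mem_liveDomain_iff.1 hu
  have hset : {v | (u.1, v) ∈ liveDomain M} = Set.Ici (max (u.1 / M.δ₁ * M.δ₂) 0) := by
    ext v
    change (u.1, v) ∈ liveDomain M ↔ _
    rw [mem_liveDomain_iff, Set.mem_Ici, max_le_iff, ← le_div_iff₀ M.δ₂_pos]
    rfl
  have hmem : u.2 ∈ Set.Ici (max (u.1 / M.δ₁ * M.δ₂) 0) :=
    max_le ((le_div_iff₀ M.δ₂_pos).1 hu'.1) hu'.2
  have hd : HasDerivWithinAt (fun v : ℝ => (u.1, v)) (0, 1) {v | (u.1, v) ∈ liveDomain M} u.2 :=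
    (hasDerivWithinAt_const _ _ _).prodMk (hasDerivWithinAt_id _ _)
  have h1 : HasDerivWithinAt (fun v => g (u.1, v)) (L (0, 1))
      {v | (u.1, v) ∈ liveDomain M} u.2 :=
    HasFDerivWithinAt.comp_hasDerivWithinAt u.2 (t := liveDomain M) h hd fun _ hv => hv
  refine h1.derivWithin ?_
  rw [hset]
  exact uniqueDiffOn_Ici _ _ hmem

/-- The integro-differential equation says that the derivative along the flow is determined by the
mean over the next claim. -/
lemma satisfiesEquationAt_iff {s : ℝ} {g : ℝ × ℝ → ℝ} {L : ℝ × ℝ →L[ℝ] ℝ} {u : ℝ × ℝ}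
    (hu : u ∈ liveDomain M) (h : HasFDerivWithinAt g L (liveDomain M) u) :
    SatisfiesEquationAt M s g u ↔
      L (M.r * (u.1 + M.c₁ / M.r), M.r * (u.2 + M.c₂ / M.r)) =
        (M.lam + s) * g u - M.lam * ∫ w, g (payClaim M w u) ∂claimLaw M := by
  have hr := M.r_pos
  have hL : ∀ a b : ℝ, L (a, b) = a * L (1, 0) + b * L (0, 1) := by
    intro a b
    rw [← smul_eq_mul, ← smul_eq_mul, ← map_smul, ← map_smul, ← map_add]
    simp
  rw [SatisfiesEquationAt, partialFst_eq hu h, partialSnd_eq hu h, integral_claimLaw,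
    hL (M.r * _)]
  simp only [payClaim]
  set I := ∫ z in Set.Ioi 0, g (u.1 - M.δ₁ * z, u.2 - M.δ₂ * z) * M.f z
  have key : (u.1 + M.c₁ / M.r) * L (1, 0) + (u.2 + M.c₂ / M.r) * L (0, 1)
      - (M.lam + s) / M.r * g u + M.lam / M.r * I =
      (M.r * (u.1 + M.c₁ / M.r) * L (1, 0) + M.r * (u.2 + M.c₂ / M.r) * L (0, 1) -
        ((M.lam + s) * g u - M.lam * I)) / M.r := by
    field_simp
    ring
  rw [key, div_eq_zero_iff, or_iff_left hr.ne', sub_eq_zero]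

end Geometry

/-! ### The Laplace transform solves the equation -/

section Equation

variable (M : Params) [IsProbabilityMeasure (claimLaw M)]

/-- The mean of the Laplace transform over the next claim. -/
def psiMean (s : ℝ) (u : ℝ × ℝ) : ℝ := ∫ w, psi M s (payClaim M w u) ∂claimLaw M

@[fun_prop]
lemma measurable_psiMean (s : ℝ) : Measurable (psiMean M s) := by
  have : Measurable fun q : (ℝ × ℝ) × ℝ => psi M s (payClaim M q.2 q.1) := by fun_prop
  exact (this.stronglyMeasurable.integral_prod_right (ν := claimLaw M)).measurable

lemma abs_psiMean_le {s : ℝ} (hs : 0 < s) (u : ℝ × ℝ) : ‖psiMean M s u‖ ≤ 1 := by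
  simpa [psiMean] using norm_integral_le_of_norm_le_const
    (μ := claimLaw M) (ae_of_all _ fun w => abs_psi_le M hs (payClaim M w u))

/-- Within the domain a jump is possible only at `u₂ = 0`: below it the function is locally 1, above
it locally a differentiable function. -/
lemma continuousAt_psi {s : ℝ} (hs : 0 < s) {u : ℝ × ℝ} (hu : u ∈ domain M) (h : u.2 ≠ 0) :
    ContinuousAt (psi M s) u := by
  rcases lt_or_gt_of_ne h with h2 | h2
  · have h1 := neg_of_mem_domain hu h2
    refine ContinuousAt.congr (f := fun _ => (1 : ℝ)) continuousAt_const ?_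
    filter_upwards [continuousAt_fst.eventually_lt continuousAt_const h1,
      continuousAt_snd.eventually_lt continuousAt_const h2] with v hv1 hv2
    exact (psi_of_neg M s (max_lt hv1 hv2)).symm
  · obtain ⟨g, hg, hpsi⟩ := exists_differentiableAt_eq_psi M hs
    refine ContinuousAt.congr (hg u (M.y₂_pos h2.le)).continuousAt ?_
    filter_upwards [continuousAt_const.eventually_lt continuousAt_snd h2] with v hv
    exact (hpsi v (le_max_of_le_right (le_of_lt hv)) (M.y₂_pos (le_of_lt hv))).symm

/-- The only possible discontinuity is met when `w = u₂/δ₂`, which has probability zero; dominated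
convergence does the rest. -/
lemma tendsto_psiMean_flow {s : ℝ} (hs : 0 < s) {u : ℝ × ℝ} (hu : u ∈ domain M) :
    ContinuousWithinAt (fun x => psiMean M s (flow M x u)) (Set.Ici 0) 0 := by
  unfold ContinuousWithinAt psiMean
  refine tendsto_integral_filter_of_dominated_convergence (fun _ => 1)
    (Eventually.of_forall fun x => (Measurable.aestronglyMeasurable (by fun_prop)))
    (Eventually.of_forall fun x => ae_of_all _ fun w => abs_psi_le M hs _)
    (integrable_const _) ?_
  have hne : ∀ᵐ w ∂claimLaw M, w ≠ u.2 / M.δ₂ :=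
    (claimLaw_absolutelyContinuous M).ae_le (Measure.ae_ne volume _)
  filter_upwards [hne] with w hw
  have h2 : (payClaim M w (flow M 0 u)).2 ≠ 0 := by
    rw [flow_zero]
    intro h
    apply hw
    rw [eq_div_iff M.δ₂_pos.ne']
    simp only [payClaim] at h
    linarith
  have hmem : payClaim M w (flow M 0 u) ∈ domain M := by
    rw [flow_zero]
    exact payClaim_mem_domain hu w
  exact (ContinuousAt.comp (f := fun x => payClaim M w (flow M x u)) (continuousAt_psi M hs hmem h2)
    ((continuous_payClaim w).comp (continuous_flow u)).continuousAt).continuousWithinAt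

/-- The renewal equation at a point of the flow line through `u`. -/
lemma psi_flow {s : ℝ} (hs : 0 < s) {u : ℝ × ℝ} (hu : 0 ≤ u.2) {x : ℝ} (hx : 0 ≤ x) :
    Real.exp (-(M.lam + s) * x) * psi M s (flow M x u) =
      ∫ v in Set.Ioi x, M.lam * Real.exp (-(M.lam + s) * v) * psiMean M s (flow M v u) := by
  rw [psi_renewal M hs (le_max_of_le_right (flow_snd_nonneg hx hu)),
    integral_expMeasure M.lam_pos, ← integral_const_mul]
  -- Substitution `v ↦ v + x`: restarting from `flow x u` traverses the same flow line with time
  -- shifted.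
  have h := (measurePreserving_add_right volume x).setIntegral_preimage_emb
    (measurableEmbedding_addRight x)
    (fun v => M.lam * Real.exp (-(M.lam + s) * v) * psiMean M s (flow M v u)) (Set.Ioi x)
  rw [← h, Set.preimage_add_const_Ioi, sub_self]
  refine integral_congr_ae (ae_of_all _ fun v => ?_)
  have he : Real.exp (-(M.lam + s) * (v + x)) =
      Real.exp (-(M.lam + s) * x) * (Real.exp (-M.lam * v) * Real.exp (-s * v)) := by
    rw [← Real.exp_add, ← Real.exp_add]
    ring_nf
  simp only [flow_flow, he, psiMean]
  ring

lemma integrableOn_psiMean_flow {s : ℝ} (hs : 0 < s) (u : ℝ × ℝ) :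
    IntegrableOn (fun v => M.lam * Real.exp (-(M.lam + s) * v) * psiMean M s (flow M v u))
      (Set.Ioi 0) := by
  have h : IntegrableOn (fun v => M.lam * Real.exp (-(M.lam + s) * v)) (Set.Ioi 0) :=
    (integrableOn_exp_mul_Ioi (by linarith [M.lam_pos]) 0).const_mul _
  refine h.mono' (Measurable.aestronglyMeasurable (by fun_prop)) (ae_of_all _ fun v => ?_)
  rw [norm_mul, norm_mul, Real.norm_eq_abs (Real.exp _), Real.abs_exp, Real.norm_eq_abs M.lam,
    abs_of_pos M.lam_pos]
  exact mul_le_of_le_one_right (mul_pos M.lam_pos (Real.exp_pos _)).le (abs_psiMean_le M hs _)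

/-- By the renewal equation the function is a constant minus the integral of `k` over `[0, x]`;
right-continuity of `k` at 0 suffices for the fundamental theorem of calculus. -/
lemma hasDerivWithinAt_psi_flow {s : ℝ} (hs : 0 < s) {u : ℝ × ℝ} (hu : u ∈ liveDomain M) :
    HasDerivWithinAt (fun x => Real.exp (-(M.lam + s) * x) * psi M s (flow M x u))
      (-(M.lam * psiMean M s u)) (Set.Ici 0) 0 := by
  have hu' := mem_liveDomain_iff.1 hu
  set k : ℝ → ℝ := fun v => M.lam * Real.exp (-(M.lam + s) * v) * psiMean M s (flow M v u) with hk
  have hint := integrableOn_psiMean_flow M hs u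
  have hkm : Measurable k := by fun_prop
  have hcont : ContinuousWithinAt k (Set.Ici 0) 0 :=
    ContinuousWithinAt.mul (by fun_prop) (tendsto_psiMean_flow M hs hu'.1)
  have h1 : HasDerivWithinAt (fun x => ∫ v in (0 : ℝ)..x, k v) (k 0) (Set.Ici 0) 0 :=
    intervalIntegral.integral_hasDerivWithinAt_right (IntervalIntegrable.refl)
      (hkm.stronglyMeasurable.stronglyMeasurableAtFilter) (hcont.mono Set.Ioi_subset_Ici_self)
  have hk0 : k 0 = M.lam * psiMean M s u := by simp [hk, flow_zero]
  rw [hk0] at h1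
  refine (h1.const_sub (∫ v in Set.Ioi 0, k v)).congr (fun x hx => ?_) ?_
  · rw [psi_flow M hs hu'.2 hx, ← intervalIntegral.integral_Ioi_sub_Ioi hint hx]
    ring
  · rw [psi_flow M hs hu'.2 le_rfl]
    simp [hk]

/-- The derivative along the flow is computed twice, by the chain rule for the smooth extension `g`
and by the renewal equation. Started on the ray, the flow leaves the domain at once, so it matters
that `psi` equals `g` on all of `u₂ ≥ 0`. -/
lemma psi_hasFDerivWithinAt {s : ℝ} (hs : 0 < s) {u : ℝ × ℝ} (hu : u ∈ liveDomain M) :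
    ∃ L : ℝ × ℝ →L[ℝ] ℝ, HasFDerivWithinAt (psi M s) L (liveDomain M) u ∧
      L (M.r * (u.1 + M.c₁ / M.r), M.r * (u.2 + M.c₂ / M.r)) =
        (M.lam + s) * psi M s u - M.lam * psiMean M s u := by
  obtain ⟨g, hg, hpsi⟩ := exists_differentiableAt_eq_psi M hs
  have hu' := mem_liveDomain_iff.1 hu
  have hL := (hg u (M.y₂_pos hu'.2)).hasFDerivAt
  have heq : ∀ v : ℝ × ℝ, 0 ≤ v.2 → psi M s v = g v := fun v hv =>
    hpsi v (le_max_of_le_right hv) (M.y₂_pos hv)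
  refine ⟨fderiv ℝ g u, hL.hasFDerivWithinAt.congr
    (fun v hv => heq v (mem_liveDomain_iff.1 hv).2) (heq u hu'.2), ?_⟩
  have hf := hasDerivAt_flow (M := M) 0 u
  rw [flow_zero] at hf
  have h1 : HasDerivAt (fun x => g (flow M x u))
      (fderiv ℝ g u (M.r * (u.1 + M.c₁ / M.r), M.r * (u.2 + M.c₂ / M.r))) 0 :=
    HasFDerivAt.comp_hasDerivAt (f := fun x => flow M x u) 0 (by rwa [flow_zero]) hf
  have he : HasDerivAt (fun x => Real.exp (-(M.lam + s) * x))
      (Real.exp (-(M.lam + s) * 0) * (-(M.lam + s))) 0 := by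
    simpa using ((hasDerivAt_id (0 : ℝ)).const_mul (-(M.lam + s))).exp
  have h2 := (he.mul h1).hasDerivWithinAt (s := Set.Ici 0)
  have h3 : HasDerivWithinAt (fun x => Real.exp (-(M.lam + s) * x) * psi M s (flow M x u)) _
      (Set.Ici 0) 0 := h2.congr
    (fun x hx => by simp [heq _ (flow_snd_nonneg hx hu'.2)])
    (by simp [heq _ (flow_snd_nonneg (M := M) le_rfl hu'.2)])
  -- Both expressions are right derivatives at 0 of the same function, hence equal.
  have h4 := (uniqueDiffWithinAt_Ici (0 : ℝ)).eq_deriv _ h3 (hasDerivWithinAt_psi_flow M hs hu)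
  rw [flow_zero, ← heq u hu'.2] at h4
  simp only [mul_zero, Real.exp_zero, one_mul] at h4
  linarith

end Equation

/-! ### Uniqueness by contraction along the flow -/

section Uniqueness

variable {M : Params}

lemma flow_mem_liveDomain {u : ℝ × ℝ} (hu : u ∈ liveDomain M) {x : ℝ} (hx : 0 ≤ x)
    (h : Real.exp (M.r * x) * (M.y₁ u.1 - M.y₂ u.2) ≤ M.b₁ - M.b₂) :
    flow M x u ∈ liveDomain M := by
  refine mem_liveDomain_iff.2 ⟨?_, flow_snd_nonneg hx (mem_liveDomain_iff.1 hu).2⟩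
  have := flow_div_sub_div (M := M) x u
  change (flow M x u).1 / M.δ₁ ≤ (flow M x u).2 / M.δ₂
  linarith

variable [IsProbabilityMeasure (claimLaw M)]

/-- A solution is not assumed measurable. Along the claim line it is continuous up to `w = u₂/δ₂`
and equal to 1 afterwards, which supplies measurability. -/
lemma integrable_payClaim {g : ℝ × ℝ → ℝ} {C : ℝ} (hb : ∀ u ∈ domain M, |g u| ≤ C)
    (hc : ContinuousOn g (liveDomain M)) (h1 : ∀ u ∈ domain M, u.1 < 0 → u.2 < 0 → g u = 1)
    {u : ℝ × ℝ} (hu : u ∈ liveDomain M) :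
    Integrable (fun w => g (payClaim M w u)) (claimLaw M) := by
  have hu' := mem_liveDomain_iff.1 hu
  refine Integrable.of_bound ?_ C (ae_of_all _ fun w => hb _ (payClaim_mem_domain hu'.1 w))
  have hmem : ∀ w ∈ Set.Iic (u.2 / M.δ₂), payClaim M w u ∈ liveDomain M := by
    intro w hw
    refine mem_liveDomain_iff.2 ⟨payClaim_mem_domain hu'.1 w, ?_⟩
    have := (le_div_iff₀ M.δ₂_pos).1 (Set.mem_Iic.1 hw)
    simp only [payClaim]
    linarith
  have hpay : Continuous fun w => payClaim M w u := by
    unfold payClaim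
    fun_prop
  have hA : AEStronglyMeasurable (fun w => g (payClaim M w u))
      ((claimLaw M).restrict (Set.Iic (u.2 / M.δ₂))) :=
    (hc.comp hpay.continuousOn hmem).aestronglyMeasurable measurableSet_Iic
  have hB : AEStronglyMeasurable (fun _ : ℝ => (1 : ℝ))
      ((claimLaw M).restrict (Set.Iic (u.2 / M.δ₂))ᶜ) := aestronglyMeasurable_const
  classical
  refine (hA.piecewise measurableSet_Iic hB).congr (ae_of_all _ fun w => ?_)
  by_cases hw : w ∈ Set.Iic (u.2 / M.δ₂)
  · simp [Set.piecewise, hw]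
  · have h2 : (payClaim M w u).2 < 0 := by
      have := (div_lt_iff₀ M.δ₂_pos).1 (not_le.1 hw)
      simp only [payClaim]
      linarith
    have hd := payClaim_mem_domain hu'.1 w
    rw [Set.piecewise_eq_of_notMem _ _ _ hw]
    exact (h1 _ hd (neg_of_mem_domain hd h2) h2).symm

/-- Along the flow, the difference of two solutions is controlled by its supremum. -/
lemma abs_sub_le_along_flow {s : ℝ} {g h : ℝ × ℝ → ℝ} {K : ℝ}
    (hg : DifferentiableOn ℝ g (liveDomain M)) (hh : DifferentiableOn ℝ h (liveDomain M))
    (heg : ∀ u ∈ liveDomain M, SatisfiesEquationAt M s g u)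
    (heh : ∀ u ∈ liveDomain M, SatisfiesEquationAt M s h u)
    (hig : ∀ u ∈ liveDomain M, Integrable (fun w => g (payClaim M w u)) (claimLaw M))
    (hih : ∀ u ∈ liveDomain M, Integrable (fun w => h (payClaim M w u)) (claimLaw M))
    (hs : 0 < s) (hK : ∀ u ∈ domain M, |g u - h u| ≤ K) {u : ℝ × ℝ} {b : ℝ} (hb : 0 ≤ b)
    (hflow : ∀ x ∈ Set.Icc 0 b, flow M x u ∈ liveDomain M) :
    |g u - h u| ≤ Real.exp (-(M.lam + s) * b) * |g (flow M b u) - h (flow M b u)| +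
      M.lam / (M.lam + s) * K * (1 - Real.exp (-(M.lam + s) * b)) := by
  have hl := M.lam_pos
  have hls : 0 < M.lam + s := by linarith
  set d : ℝ × ℝ → ℝ := fun v => g v - h v with hd
  have hdiff : DifferentiableOn ℝ d (liveDomain M) := hg.sub hh
  set φ : ℝ → ℝ := fun x => Real.exp (-(M.lam + s) * x) * d (flow M x u) with hφ
  set I : ℝ → ℝ := fun x => ∫ w, d (payClaim M w (flow M x u)) ∂claimLaw M with hI
  have he : ∀ x, HasDerivAt (fun x => Real.exp (-(M.lam + s) * x))
      (Real.exp (-(M.lam + s) * x) * (-(M.lam + s))) x := fun x => by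
    simpa using ((hasDerivAt_id x).const_mul (-(M.lam + s))).exp
  have hφ' : ∀ x ∈ Set.Icc 0 b, HasDerivWithinAt φ
      (-(M.lam * Real.exp (-(M.lam + s) * x) * I x)) (Set.Icc 0 b) x := by
    intro x hx
    have hmem := hflow x hx
    have hLg := (hg _ hmem).hasFDerivWithinAt
    have hLh := (hh _ hmem).hasFDerivWithinAt
    have h1 := (satisfiesEquationAt_iff hmem hLg).1 (heg _ hmem)
    have h2 := (satisfiesEquationAt_iff hmem hLh).1 (heh _ hmem)
    have hIx : I x = ∫ w, g (payClaim M w (flow M x u)) ∂claimLaw M -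
        ∫ w, h (payClaim M w (flow M x u)) ∂claimLaw M :=
      integral_sub (hig _ hmem) (hih _ hmem)
    have h3 := HasFDerivWithinAt.comp_hasDerivWithinAt x (f := fun x => flow M x u)
      (t := liveDomain M) (hLg.sub hLh)
      (hasDerivAt_flow (M := M) x u).hasDerivWithinAt hflow
    have h4 := (he x).hasDerivWithinAt.mul h3
    refine h4.congr_deriv ?_
    rw [sub_apply, h1, h2, hIx]
    simp only [Function.comp_apply, Pi.sub_apply]
    ring
  have hφc : ContinuousOn φ (Set.Icc 0 b) := fun x hx => (hφ' x hx).continuousWithinAt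
  have hIb : ∀ x ∈ Set.Icc 0 b, |I x| ≤ K := by
    intro x hx
    have := norm_integral_le_of_norm_le_const (μ := claimLaw M)
      (f := fun w => d (payClaim M w (flow M x u))) (ae_of_all _ fun w =>
      hK _ (payClaim_mem_domain (mem_liveDomain_iff.1 (hflow x hx)).1 w))
    simpa using this
  have hB : ∀ x, HasDerivAt (fun x => M.lam / (M.lam + s) * K *
      (1 - Real.exp (-(M.lam + s) * x))) (M.lam * Real.exp (-(M.lam + s) * x) * K) x := by
    intro x
    refine (((he x).const_sub 1).const_mul (M.lam / (M.lam + s) * K)).congr_deriv ?_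
    field_simp
  -- Mean value inequality: `|φ'|` is at most `λ K exp(-(λ+s) x)`, whose primitive vanishing at 0 is
  -- the boundary function.
  have hmain := image_norm_le_of_norm_deriv_right_le_deriv_boundary
    (f := fun x => φ x - φ 0) (f' := fun x => -(M.lam * Real.exp (-(M.lam + s) * x) * I x))
    (hφc.sub continuousOn_const)
    (fun x hx => ((hφ' x ⟨hx.1, hx.2.le⟩).mono_of_mem_nhdsWithin
      (Icc_mem_nhdsGE_of_mem hx)).sub_const _) (by simp) hB
    (fun x hx => by
      rw [norm_neg, norm_mul, Real.norm_eq_abs, Real.norm_eq_abs,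
        abs_of_pos (mul_pos hl (Real.exp_pos _))]
      exact mul_le_mul_of_nonneg_left (hIb x ⟨hx.1, hx.2.le⟩)
        (mul_pos hl (Real.exp_pos _)).le) (Set.right_mem_Icc.2 hb)
  have hφ0 : φ 0 = g u - h u := by simp [hφ, hd, flow_zero]
  have hφb : |φ b| = Real.exp (-(M.lam + s) * b) * |g (flow M b u) - h (flow M b u)| := by
    rw [hφ, abs_mul, Real.abs_exp]
  rw [← hφ0, ← hφb]
  rw [Real.norm_eq_abs] at hmain
  have := abs_sub_abs_le_abs_sub (φ 0) (φ b)
  rw [abs_sub_comm (φ 0)] at this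
  linarith

/-- The supremum of the difference of two solutions contracts. -/
lemma abs_sub_le_ratio_mul {s : ℝ} {g h : ℝ × ℝ → ℝ} {K : ℝ}
    (hg : DifferentiableOn ℝ g (liveDomain M)) (hh : DifferentiableOn ℝ h (liveDomain M))
    (heg : ∀ u ∈ liveDomain M, SatisfiesEquationAt M s g u)
    (heh : ∀ u ∈ liveDomain M, SatisfiesEquationAt M s h u)
    (hig : ∀ u ∈ liveDomain M, Integrable (fun w => g (payClaim M w u)) (claimLaw M))
    (hih : ∀ u ∈ liveDomain M, Integrable (fun w => h (payClaim M w u)) (claimLaw M))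
    (hray : ∀ x, g (x, M.δ₂ / M.δ₁ * x) = h (x, M.δ₂ / M.δ₁ * x))
    (hruin : ∀ u ∈ domain M, u.1 < 0 → u.2 < 0 → g u = h u)
    (hs : 0 < s) (hK : ∀ u ∈ domain M, |g u - h u| ≤ K) {u : ℝ × ℝ} (hu : u ∈ domain M) :
    |g u - h u| ≤ M.lam / (M.lam + s) * K := by
  have hl := M.lam_pos
  have hls : 0 < M.lam + s := by linarith
  have hK0 : 0 ≤ K := (abs_nonneg _).trans (hK u hu)
  have hρ := ratio_nonneg M hs
  rcases lt_or_ge u.2 0 with h2 | h2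
  · rw [hruin u hu (neg_of_mem_domain hu h2) h2, sub_self, abs_zero]
    positivity
  have hlive : u ∈ liveDomain M := mem_liveDomain_iff.2 ⟨hu, h2⟩
  have along := fun (b : ℝ) (hb : 0 ≤ b) => abs_sub_le_along_flow hg hh heg heh hig hih hs hK
    (u := u) hb
  have hκ : 0 < M.b₁ - M.b₂ := sub_pos.2 M.b₂_lt_b₁
  rcases le_or_gt (M.y₁ u.1 - M.y₂ u.2) 0 with hX | hX
  -- The flow never leaves the live domain; letting `b → ∞` removes the endpoint term.
  · have hb : ∀ b : ℝ, 0 ≤ b →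
        |g u - h u| ≤ Real.exp (-(M.lam + s) * b) * K + M.lam / (M.lam + s) * K := by
      intro b hb
      have hfl : ∀ x, 0 ≤ x → flow M x u ∈ liveDomain M := fun x hx =>
        flow_mem_liveDomain hlive hx
          ((mul_nonpos_of_nonneg_of_nonpos (Real.exp_pos _).le hX).trans hκ.le)
      refine (along b hb fun x hx => hfl x hx.1).trans ?_
      have h3 := hK _ (mem_liveDomain_iff.1 (hfl b hb)).1
      have h4 := Real.exp_pos (-(M.lam + s) * b)
      have h5 : M.lam / (M.lam + s) * K * (1 - Real.exp (-(M.lam + s) * b)) ≤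
          M.lam / (M.lam + s) * K := mul_le_of_le_one_right (by positivity) (by linarith)
      gcongr
    have hlim : Tendsto (fun b : ℝ => Real.exp (-(M.lam + s) * b) * K + M.lam / (M.lam + s) * K)
        atTop (𝓝 (0 * K + M.lam / (M.lam + s) * K)) := by
      refine (Tendsto.mul_const K ?_).add_const _
      exact Real.tendsto_exp_atBot.comp
        (tendsto_id.const_mul_atTop_of_neg (by linarith : -(M.lam + s) < 0))
    rw [zero_mul, zero_add] at hlim
    refine ge_of_tendsto hlim ?_
    filter_upwards [eventually_ge_atTop 0] with b hb'
    exact hb b hb'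
  -- Here `b` is the time at which the flow meets the ray, where the two solutions agree by the
  -- boundary condition.
  · set b := Real.log ((M.b₁ - M.b₂) / (M.y₁ u.1 - M.y₂ u.2)) / M.r with hbdef
    have hrb : Real.exp (M.r * b) = (M.b₁ - M.b₂) / (M.y₁ u.1 - M.y₂ u.2) := by
      rw [hbdef, mul_div_cancel₀ _ M.r_pos.ne', Real.exp_log (div_pos hκ hX)]
    have hXκ : M.y₁ u.1 - M.y₂ u.2 ≤ M.b₁ - M.b₂ := by
      have : u.1 / M.δ₁ ≤ u.2 / M.δ₂ := hu
      simp only [Params.y₁, Params.y₂]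
      linarith
    have hb : 0 ≤ b := div_nonneg (Real.log_nonneg ((one_le_div hX).2 hXκ)) M.r_pos.le
    have hexp : Real.exp (M.r * b) * (M.y₁ u.1 - M.y₂ u.2) = M.b₁ - M.b₂ := by
      rw [hrb, div_mul_cancel₀ _ hX.ne']
    have hfl : ∀ x ∈ Set.Icc 0 b, flow M x u ∈ liveDomain M := by
      intro x hx
      refine flow_mem_liveDomain hlive hx.1 ?_
      rw [← hexp]
      refine mul_le_mul_of_nonneg_right (Real.exp_le_exp.2 ?_) hX.le
      exact mul_le_mul_of_nonneg_left hx.2 M.r_pos.le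
    have hmain := along b hb hfl
    have hzero : g (flow M b u) - h (flow M b u) = 0 := by
      have h3 := flow_div_sub_div (M := M) b u
      rw [hexp, sub_self, sub_eq_zero] at h3
      have h4 : flow M b u = ((flow M b u).1, M.δ₂ / M.δ₁ * (flow M b u).1) := by
        refine Prod.ext rfl ?_
        have h5 := M.δ₁_pos
        have h6 := M.δ₂_pos
        rw [div_eq_div_iff h5.ne' h6.ne'] at h3
        field_simp
        linarith
      rw [h4, hray, sub_self]
    rw [hzero, abs_zero, mul_zero, zero_add] at hmain
    refine hmain.trans (mul_le_of_le_one_right (by positivity) ?_)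
    linarith [Real.exp_pos (-(M.lam + s) * b)]

end Uniqueness

/-! ### Boundary condition, existence and uniqueness -/

section Solution

variable {Ω : Type*} [MeasurableSpace Ω] {P : Measure Ω} [IsProbabilityMeasure P] {M : Params}
  {T σ : ℕ → Ω → ℝ} {s : ℝ}

omit [MeasurableSpace Ω] in
lemma TMax_ray (x : ℝ) (ω : Ω) : TMax M T σ (x, M.δ₂ / M.δ₁ * x) ω = τ₁ M T σ x ω := by
  have hr := M.r_pos
  have h1 := M.δ₁_pos
  have h2 := M.δ₂_pos
  have key : ∀ t : ℝ, 0 ≤ t → (max (U₁ M T σ x t ω) (U₂ M T σ (M.δ₂ / M.δ₁ * x) t ω) < 0 ↔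
      U₁ M T σ x t ω < 0) := by
    intro t ht
    rw [max_lt_iff, and_iff_left_iff_imp]
    simp only [U₁, U₂]
    rw [surplus_neg_iff hr h1, surplus_neg_iff hr h2]
    have hx : M.δ₂ / M.δ₁ * x / M.δ₂ = x / M.δ₁ := by field_simp
    rw [hx]
    intro h
    have he : Real.exp (-M.r * t) ≤ 1 := Real.exp_le_one_iff.2 (by nlinarith)
    have hb : M.c₂ / (M.r * M.δ₂) ≤ M.c₁ / (M.r * M.δ₁) := M.b₂_lt_b₁.le
    nlinarith [mul_le_mul_of_nonneg_left he (sub_nonneg.2 hb)]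
  rw [TMax, τ₁, ruinTime, ruinTime]
  congr 2
  ext t
  exact and_congr_right fun ht => key t ht

lemma isSolution_PsiMax (hmodel : IsClaimModel M P T σ) (hs : 0 < s) :
    IsSolution M P T σ s (PsiMax M P T σ s) := by
  have := hmodel.isProbabilityMeasure_claimLaw
  have heq : PsiMax M P T σ s = psi M s := funext fun u => PsiMax_eq_psi hmodel s u
  refine ⟨⟨1, fun u _ => ?_⟩, fun u hu => ?_, fun u hu => ?_, fun u _ h1 h2 => ?_, fun x => ?_⟩
  · rw [heq]
    exact abs_psi_le M hs u
  · rw [heq]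
    obtain ⟨L, hL, -⟩ := psi_hasFDerivWithinAt M hs hu
    exact hL.differentiableWithinAt
  · rw [heq]
    obtain ⟨L, hL, hLu⟩ := psi_hasFDerivWithinAt M hs hu
    exact (satisfiesEquationAt_iff hu hL).2 hLu
  · rw [heq, psi_of_neg M s (max_lt h1 h2)]
  · simp only [PsiMax, TMax_ray]

lemma IsSolution.eq_of_isSolution {g h : ℝ × ℝ → ℝ} (hmodel : IsClaimModel M P T σ) (hs : 0 < s)
    (hg : IsSolution M P T σ s g) (hh : IsSolution M P T σ s h) {u : ℝ × ℝ} (hu : u ∈ domain M) :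
    g u = h u := by
  have := hmodel.isProbabilityMeasure_claimLaw
  obtain ⟨A, hA⟩ := hg.bounded
  obtain ⟨B, hB⟩ := hh.bounded
  have hig : ∀ u ∈ liveDomain M, Integrable (fun w => g (payClaim M w u)) (claimLaw M) :=
    fun u hu => integrable_payClaim hA hg.differentiable.continuousOn hg.ruined hu
  have hih : ∀ u ∈ liveDomain M, Integrable (fun w => h (payClaim M w u)) (claimLaw M) :=
    fun u hu => integrable_payClaim hB hh.differentiable.continuousOn hh.ruined hu
  -- The starting bound is the sum of the bounds of the two solutions; each contraction step gains a
  -- factor `λ/(λ+s)`.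
  have hn : ∀ n : ℕ, ∀ v ∈ domain M, |g v - h v| ≤ (M.lam / (M.lam + s)) ^ n * (A + B) := by
    intro n
    induction n with
    | zero =>
      intro v hv
      rw [pow_zero, one_mul]
      exact (abs_sub _ _).trans (add_le_add (hA v hv) (hB v hv))
    | succ n ih =>
      intro v hv
      rw [pow_succ', mul_assoc]
      exact abs_sub_le_ratio_mul hg.differentiable hh.differentiable hg.equation hh.equation hig hih
        (fun x => (hg.boundary x).trans (hh.boundary x).symm)
        (fun v hv h1 h2 => (hg.ruined v hv h1 h2).trans (hh.ruined v hv h1 h2).symm) hs ih hv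
  have hlim : Tendsto (fun n : ℕ => (M.lam / (M.lam + s)) ^ n * (A + B)) atTop
      (𝓝 (0 * (A + B))) :=
    (tendsto_pow_atTop_nhds_zero_of_lt_one (ratio_nonneg M hs) (ratio_lt_one M hs)).mul_const _
  have h0 : |g u - h u| ≤ 0 * (A + B) := ge_of_tendsto' hlim fun n => hn n u hu
  rw [zero_mul] at h0
  exact sub_eq_zero.1 (abs_nonpos_iff.1 h0)

end Solution

end JointRuin

end

theorem theorem2p2 {Ω : Type*} [MeasurableSpace Ω] (P : MeasureTheory.Measure Ω)
    [MeasureTheory.IsProbabilityMeasure P] (M : JointRuin.Params) (T σ : ℕ → Ω → ℝ)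
    (hmodel : JointRuin.IsClaimModel M P T σ) (s : ℝ) (hs : 0 < s) :
    JointRuin.IsSolution M P T σ s (JointRuin.PsiMax M P T σ s) ∧
      ∀ g : ℝ × ℝ → ℝ, JointRuin.IsSolution M P T σ s g →
        ∀ u ∈ JointRuin.domain M, g u = JointRuin.PsiMax M P T σ s u :=
  ⟨JointRuin.isSolution_PsiMax hmodel hs, fun _ hg _ hu =>
    hg.eq_of_isSolution hmodel hs (JointRuin.isSolution_PsiMax hmodel hs) hu⟩
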